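/- Let $N,K\ge1$ be integers, $\gamma\in(0,1]$, $\epsilon>0$, $\delta\in(0,1)$, and let $x\in\mathbb{R}^N$ have nonnegative coordinates, at most $K$ of them nonzero. For $\alpha\in(0,1)$ let $S(\alpha,1,1)$ be the maximally skewed $\alpha$-stable law of unit scale, i.e. the law with characteristic function $t\mapsto\exp\!\big(-|t|^\alpha(1-\sqrt{-1}\,\mathrm{sign}(t)\tan(\pi\alpha/2))\big)$. Let $s_{ij}$ and $r_{ij}$ ($1\le i\le N$, $1\le j\le M$) be mutually independent random variables with $s_{ij}\sim S(\alpha,1,1)$, $\Pr(r_{ij}=1)=\gamma$ and $\Pr(r_{ij}=0)=1-\gamma$. Put $$y_j=\sum_{i=1}^N x_i s_{ij}r_{ij},\qquad \hat x_i=\min_{j:\,r_{ij}=1}\frac{y_j}{s_{ij}r_{ij}},$$ with $\hat x_i=+\infty$ if there is no $j$ with $r_{ij}=1$. Define $$M_0=\frac{1}{-\log\left[1-\frac{1}{K+1}\left(1-(1-\gamma)^{K+1}\right)\right]}\,\log\frac{N}{\delta}.$$ Then there is $\alpha_0\in(0,1)$, depending on $N,K,\gamma,\epsilon,\delta,x$,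 such that for all $\alpha\in(0,\alpha_0)$ and all integers $M\ge0$ with $M\ge M_0$, $$\Pr\left(x_i\le\hat x_i\le x_i+\epsilon\ \text{ for all } i=1,\dots,N\right)\ \ge\ 1-\delta .$$ Moreover $M_0$ is essentially $M_1=\frac{K}{1-e^{-\gamma K}}\log\frac{N}{\delta}$: for every $\eta>0$ there is $K_0$ such that $|M_0-M_1|\le\eta M_1$ for all $K\ge K_0$ and all $N\ge1$, $\gamma\in(0,1]$, $\delta\in(0,1)$. -/

import Mathlib

open MeasureTheory ProbabilityTheory Filter Topology

noncomputable section

namespace SparseCC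

/-- `μ` is the maximally skewed stable law `S(α, 1, 1)` (index `α`, skewness `1`, unit scale):
its characteristic function is `exp (-|t|^α * (1 - i * sign t * tan (π α / 2)))`. -/
def IsMaxSkewedStable (α : ℝ) (μ : Measure ℝ) : Prop :=
  ∀ t : ℝ, charFun μ t =
    Complex.exp (-((|t| ^ α : ℝ) : ℂ) *
      (1 - Complex.I * ((Real.sign t * Real.tan (Real.pi * α / 2) : ℝ) : ℂ)))

/-- The `N × M` random arrays `s`, `r` generate the sparsified design matrix `(s i j * r i j)`:
the `s i j` have law `S(α, 1, 1)`, the `r i j` equal `1` with probability `γ` and `0` with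
probability `1 - γ`, and all these `2 N M` random variables are mutually independent. -/
structure IsSparseStableDesign {Ω : Type*} [MeasurableSpace Ω] {N M : ℕ} (α : ℝ)
    (γ : unitInterval) (s r : Fin N → Fin M → Ω → ℝ) (P : Measure Ω) : Prop where
  measurable_s : ∀ i j, Measurable (s i j)
  measurable_r : ∀ i j, Measurable (r i j)
  law_s : ∀ i j, IsMaxSkewedStable α (P.map (s i j))
  law_r : ∀ i j, P.map (r i j) = bernoulliMeasure (1 : ℝ) 0 γ
  indep : iIndepFun
    (Sum.elim (fun p : Fin N × Fin M => s p.1 p.2) (fun p : Fin N × Fin M => r p.1 p.2)) P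

/-- The measurement `y_j = ∑ i, x_i * (s_ij * r_ij)`. -/
def measurement {N M : ℕ} (x : Fin N → ℝ) (s r : Fin N → Fin M → ℝ) (j : Fin M) : ℝ :=
  ∑ i, x i * (s i j * r i j)

/-- The min-ratio estimate of the `i`-th coordinate from the data `y`:
the minimum of `y_j / (s_ij * r_ij)` over the `j` with `r_ij = 1`, which is `+∞` if there is
no such `j`. -/
def minRatioEstimator {N M : ℕ} (s r : Fin N → Fin M → ℝ) (y : Fin M → ℝ) (i : Fin N) : EReal :=
  ⨅ j ∈ {j : Fin M | r i j = 1}, ((y j / (s i j * r i j) : ℝ) : EReal)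

/-- `log (N / δ) / (-log (1 - (1 - (1 - γ)^(K+1)) / (K + 1)))`. -/
def requiredMeasurements (N K : ℕ) (γ δ : ℝ) : ℝ :=
  1 / (-Real.log (1 - 1 / ((K : ℝ) + 1) * (1 - (1 - γ) ^ (K + 1)))) * Real.log (N / δ)

/-- `K / (1 - exp (-γ K)) * log (N / δ)`. -/
def approxMeasurements (N K : ℕ) (γ δ : ℝ) : ℝ :=
  (K : ℝ) / (1 - Real.exp (-γ * K)) * Real.log (N / δ)

end SparseCC

end

/-! For small `α` the positive stable variables live on such different scales that one term
dominates each sum, and the sizes of the nonzero `x t` stop mattering since `x t ^ α → 1`. A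
measurement pins down coordinate `i` when `r i j = 1` and the `i`-th term dominates. With `n` other
nonzero coordinates this has limiting probability `limitSuccess γ n`, the chance of being active and
the largest among the active terms.

The dominance estimate uses Laplace transforms. The law `S(α,1,1)` is a weak limit of scaled sums of
Sibuya variables, hence lives on `(0,∞)` with transform `exp (-c l ^ α)`, `c = 1 / cos (π α / 2)`
(`SparseCC.IsMaxSkewedStable.integral_exp`). If `Y` is the contribution of the other coordinates and
`S` the `i`-th stable variable, then `κS/(Y+κS) = ∫ κS exp (-l(Y+κS)) dl` over `l > 0`, so its mean
is bounded below by an explicit integral. Markov's inequality turns this into a bound for `Y ≤ ε S`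
(`le_measureReal_informative`).

Columns are independent, so a coordinate fails with probability at most `(1 - q) ^ M`, and a union
bound finishes. Passing to the limit needs strict slack: some coordinate has fewer than `K` nonzero
competitors, and `limitSuccess` is strictly decreasing.

The comparison of `M_0` with `M_1` follows from `p ≤ -log (1 - p) ≤ p / (1 - p)` and a bound on `exp
(-γK) - (1-γ)^(K+1)`. -/

/-! ### The Sibuya law and its generating function -/

/-- The Sibuya weights: the coefficients of `1 - (1 - z) ^ α`. -/
noncomputable def sibuyaCoeff (α : ℝ) (k : ℕ) : ℝ :=
  if k = 0 then 0 else -((-1) ^ k * Ring.choose α k)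

lemma Ring.choose_succ_mul (a : ℝ) (k : ℕ) :
    Ring.choose a (k + 1) * (k + 1) = Ring.choose a k * (a - k) := by
  have h := Ring.choose_smul_choose a (Nat.le_succ k)
  simp only [Nat.succ_eq_add_one, Nat.choose_succ_self_right, Nat.add_sub_cancel_left,
    Ring.choose_one_right, nsmul_eq_mul, Nat.cast_add, Nat.cast_one] at h
  linarith

/-- For `k ≥ 1` consecutive weights have ratio `(k - α) / (k + 1)`, which is positive because `α <
1`. -/
lemma sibuyaCoeff_nonneg {α : ℝ} (h0 : 0 < α) (h1 : α < 1) (k : ℕ) : 0 ≤ sibuyaCoeff α k := by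
  rcases k with _ | k
  · simp [sibuyaCoeff]
  · induction k with
    | zero => simpa [sibuyaCoeff] using h0.le
    | succ k ih =>
      have h := Ring.choose_succ_mul α (k + 1)
      simp only [sibuyaCoeff, Nat.succ_ne_zero, if_false] at ih ⊢
      have hk : (0 : ℝ) < (↑(k + 1) : ℝ) + 1 := by positivity
      have : -((-1) ^ (k + 1 + 1) * Ring.choose α (k + 1 + 1)) * ((↑(k + 1) : ℝ) + 1)
          = -((-1) ^ (k + 1) * Ring.choose α (k + 1)) * ((k + 1 : ℕ) - α) := by
        rw [pow_succ]; linear_combination ((-1) ^ (k + 1)) * h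
      refine nonneg_of_mul_nonneg_left (b := (↑(k + 1) : ℝ) + 1) ?_ hk
      rw [this]
      refine mul_nonneg ih ?_
      push_cast
      have : (0 : ℝ) ≤ k := k.cast_nonneg
      linarith

lemma hasSum_sibuyaCoeff_of_norm_lt_one (α : ℝ) {z : ℂ} (hz : ‖z‖ < 1) :
    HasSum (fun k ↦ (sibuyaCoeff α k : ℂ) * z ^ k) (1 - (1 - z) ^ (α : ℂ)) := by
  have h := (Complex.one_add_cpow_hasFPowerSeriesOnBall_zero (a := α)).hasSum (y := -z) (by
    rw [Metric.mem_eball, edist_zero_right, enorm_neg, ← ofReal_norm]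
    exact ENNReal.ofReal_lt_one.2 hz)
  simp only [binomialSeries_apply, List.ofFn_const, List.prod_replicate, smul_eq_mul, zero_add,
    ← sub_eq_add_neg (1 : ℂ) z] at h
  refine ((hasSum_ite_eq (0 : ℕ) (1 : ℂ)).sub h).congr_fun fun k ↦ ?_
  rcases k with _ | k
  · simp [sibuyaCoeff]
  · simp only [sibuyaCoeff, Nat.succ_ne_zero, if_false, ← Complex.ofReal_choose, neg_pow z]
    push_cast
    ring

lemma summable_sibuyaCoeff {α : ℝ} (h0 : 0 < α) (h1 : α < 1) : Summable (sibuyaCoeff α) := by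
  refine summable_of_sum_range_le (c := 1) (sibuyaCoeff_nonneg h0 h1) fun n ↦ ?_
  -- Inside the disc the series sums to `1 - (1 - r) ^ α ≤ 1`; letting `r → 1` in each finite
  -- partial sum gives the uniform bound.
  have key : ∀ r ∈ Set.Ioo (0 : ℝ) 1, ∑ k ∈ Finset.range n, sibuyaCoeff α k * r ^ k ≤ 1 := by
    intro r hr
    have h := hasSum_sibuyaCoeff_of_norm_lt_one α (z := (r : ℂ))
      (by rw [Complex.norm_real, Real.norm_of_nonneg hr.1.le]; exact hr.2)
    have e : (1 : ℂ) - (1 - r) ^ (α : ℂ) = ((1 - (1 - r) ^ α : ℝ) : ℂ) := by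
      rw [Complex.ofReal_sub, Complex.ofReal_cpow (by linarith [hr.2])]
      simp
    rw [e] at h
    have h' : HasSum (fun k ↦ sibuyaCoeff α k * r ^ k) (1 - (1 - r) ^ α) := by
      exact_mod_cast h
    refine (h'.summable.sum_le_tsum _ fun k _ ↦
      mul_nonneg (sibuyaCoeff_nonneg h0 h1 k) (pow_nonneg hr.1.le k)).trans ?_
    rw [h'.tsum_eq]
    have : 0 ≤ (1 - r) ^ α := Real.rpow_nonneg (by linarith [hr.2]) _
    linarith
  have hc : Tendsto (fun r : ℝ ↦ ∑ k ∈ Finset.range n, sibuyaCoeff α k * r ^ k) (𝓝[<] 1)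
      (𝓝 (∑ k ∈ Finset.range n, sibuyaCoeff α k * 1 ^ k)) := by
    refine Tendsto.mono_left ?_ nhdsWithin_le_nhds
    exact Continuous.tendsto (by fun_prop) 1
  have := le_of_tendsto hc (by
    filter_upwards [Ioo_mem_nhdsLT (show (0 : ℝ) < 1 by norm_num)] with r hr using key r hr)
  simpa using this

/-- The generating function of the Sibuya weights on the closed unit disc. -/
lemma hasSum_sibuyaCoeff {α : ℝ} (h0 : 0 < α) (h1 : α < 1) {z : ℂ} (hz : ‖z‖ ≤ 1) :
    HasSum (fun k ↦ (sibuyaCoeff α k : ℂ) * z ^ k) (1 - (1 - z) ^ (α : ℂ)) := by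
  have hs := summable_sibuyaCoeff h0 h1
  have hb : ∀ k, ∀ w ∈ Metric.closedBall (0 : ℂ) 1, ‖(sibuyaCoeff α k : ℂ) * w ^ k‖
      ≤ sibuyaCoeff α k := by
    intro k w hw
    rw [norm_mul, Complex.norm_real, Real.norm_of_nonneg (sibuyaCoeff_nonneg h0 h1 k), norm_pow]
    exact mul_le_of_le_one_right (sibuyaCoeff_nonneg h0 h1 k)
      (pow_le_one₀ (norm_nonneg _) (by simpa using hw))
  have hz' : z ∈ Metric.closedBall (0 : ℂ) 1 := by simpa using hz
  have hcont : ContinuousOn (fun w ↦ ∑' k, (sibuyaCoeff α k : ℂ) * w ^ k)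
      (Metric.closedBall (0 : ℂ) 1) :=
    continuousOn_tsum (fun k ↦ by fun_prop) hs hb
  have hsum : Summable fun k ↦ (sibuyaCoeff α k : ℂ) * z ^ k :=
    Summable.of_norm_bounded hs fun k ↦ hb k z hz'
  have hmem : ∀ r ∈ Set.Ioo (0 : ℝ) 1, ‖(r : ℂ) * z‖ < 1 := by
    intro r hr
    rw [norm_mul, Complex.norm_real, Real.norm_of_nonneg hr.1.le]
    nlinarith [hr.1, hr.2, norm_nonneg z]
  -- Both sides are continuous up to the boundary, so the identity extends along the radius through
  -- `z`.
  have hray : Tendsto (fun r : ℝ ↦ (r : ℂ) * z) (𝓝[<] 1) (𝓝 z) := by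
    refine Tendsto.mono_left ?_ nhdsWithin_le_nhds
    have : Continuous fun r : ℝ ↦ (r : ℂ) * z := by fun_prop
    simpa using this.tendsto 1
  have hIoo : ∀ᶠ r : ℝ in 𝓝[<] 1, r ∈ Set.Ioo (0 : ℝ) 1 :=
    Ioo_mem_nhdsLT (show (0 : ℝ) < 1 by norm_num)
  have l1 : Tendsto (fun r : ℝ ↦ ∑' k, (sibuyaCoeff α k : ℂ) * ((r : ℂ) * z) ^ k) (𝓝[<] 1)
      (𝓝 (∑' k, (sibuyaCoeff α k : ℂ) * z ^ k)) := by
    refine (hcont z hz').tendsto.comp (tendsto_nhdsWithin_iff.2 ⟨hray, ?_⟩)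
    filter_upwards [hIoo] with r hr
    simpa using (hmem r hr).le
  have l2 : Tendsto (fun r : ℝ ↦ 1 - (1 - (r : ℂ) * z) ^ (α : ℂ)) (𝓝[<] 1)
      (𝓝 (1 - (1 - z) ^ (α : ℂ))) := by
    refine tendsto_const_nhds.sub ?_
    have hre : 0 ≤ (1 - z).re := by
      have := (Complex.re_le_norm z).trans hz
      simpa using this
    exact (Complex.continuousAt_cpow_const_of_re_pos (Or.inl hre) (by simpa using h0)).tendsto.comp
      (tendsto_const_nhds.sub hray)
  have : ∑' k, (sibuyaCoeff α k : ℂ) * z ^ k = 1 - (1 - z) ^ (α : ℂ) := by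
    refine tendsto_nhds_unique (l1.congr' ?_) l2
    filter_upwards [hIoo] with r hr
    exact (hasSum_sibuyaCoeff_of_norm_lt_one α (hmem r hr)).tsum_eq
  exact this ▸ hsum.hasSum

/-- The Sibuya law on `ℕ`, with generating function `1 - (1 - z) ^ α`. -/
lemma exists_pmf_integral_pow {α : ℝ} (h0 : 0 < α) (h1 : α < 1) :
    ∃ p : PMF ℕ, ∀ z : ℂ, ‖z‖ ≤ 1 → ∫ k, z ^ k ∂p.toMeasure = 1 - (1 - z) ^ (α : ℂ) := by
  have hs : HasSum (sibuyaCoeff α) 1 := by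
    have := hasSum_sibuyaCoeff h0 h1 (z := 1) (by simp)
    rw [sub_self, Complex.zero_cpow (by exact_mod_cast h0.ne'), sub_zero] at this
    simp only [one_pow, mul_one] at this
    exact Complex.hasSum_ofReal.1 (by simpa using this)
  have hs' : HasSum (fun k ↦ ENNReal.ofReal (sibuyaCoeff α k)) 1 := by
    have := ENNReal.ofReal_tsum_of_nonneg (sibuyaCoeff_nonneg h0 h1) hs.summable
    rw [hs.tsum_eq, ENNReal.ofReal_one] at this
    exact this ▸ ENNReal.summable.hasSum
  obtain ⟨p, hp⟩ : ∃ p : PMF ℕ, ∀ k, p k = ENNReal.ofReal (sibuyaCoeff α k) :=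
    ⟨⟨_, hs'⟩, fun _ ↦ rfl⟩
  refine ⟨p, fun z hz ↦ ?_⟩
  rw [PMF.integral_eq_tsum, ← (hasSum_sibuyaCoeff h0 h1 hz).tsum_eq]
  · refine tsum_congr fun k ↦ ?_
    rw [hp, ENNReal.toReal_ofReal (sibuyaCoeff_nonneg h0 h1 k), Complex.real_smul]
  · refine Integrable.of_bound (by fun_prop) 1 (.of_forall fun k ↦ ?_)
    rw [norm_pow]
    exact pow_le_one₀ (norm_nonneg _) hz

/-! ### The stable law as a limit of scaled Sibuya sums -/

/-- The law of `h` times a sum of `n` independent copies of an `ℕ`-valued variable. -/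
lemma exists_scaled_sum_law {α h : ℝ} (h0 : 0 < α) (h1 : α < 1) (hh : 0 ≤ h) (n : ℕ) :
    ∃ ν : ProbabilityMeasure ℝ, (ν : Measure ℝ) (Set.Iio 0) = 0 ∧
      ∀ w : ℂ, w.re ≤ 0 → ∫ x : ℝ, Complex.exp (w * x) ∂(ν : Measure ℝ) =
        (1 - (1 - Complex.exp (w * h)) ^ (α : ℂ)) ^ n := by
  obtain ⟨p, hp⟩ := exists_pmf_integral_pow h0 h1
  let π := Measure.pi fun _ : Fin n ↦ p.toMeasure
  let f : (Fin n → ℕ) → ℝ := fun k ↦ h * ∑ i, (k i : ℝ)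
  have hf : Measurable f := by fun_prop
  refine ⟨⟨π.map f, Measure.isProbabilityMeasure_map hf.aemeasurable⟩, ?_, fun w hw ↦ ?_⟩
  · change π.map f _ = 0
    rw [Measure.map_apply hf measurableSet_Iio]
    convert measure_empty (μ := π)
    ext k
    simp only [Set.mem_preimage, Set.mem_Iio, Set.mem_empty_iff_false, iff_false, not_lt, f]
    positivity
  · change ∫ x : ℝ, Complex.exp (w * x) ∂(π.map f) = _
    rw [integral_map hf.aemeasurable (by fun_prop)]
    have : ∀ k : Fin n → ℕ, Complex.exp (w * f k) = ∏ i, Complex.exp (w * h) ^ (k i) := by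
      intro k
      rw [Finset.prod_pow_eq_pow_sum, ← Complex.exp_nat_mul]
      congr 1
      simp only [f]
      push_cast
      ring
    simp_rw [this]
    rw [integral_fintype_prod_eq_pow (fun k : ℕ ↦ Complex.exp (w * h) ^ k), hp, Fintype.card_fin]
    rw [Complex.norm_exp]
    refine Real.exp_le_one_iff.2 ?_
    rw [Complex.re_mul_ofReal]
    exact mul_nonpos_of_nonpos_of_nonneg hw hh

lemma Complex.ofReal_mul_cpow_ofReal {h α : ℝ} (hh : 0 < h) (hα : 0 < α) (z : ℂ) :
    ((h : ℂ) * z) ^ (α : ℂ) = ((h ^ α : ℝ) : ℂ) * z ^ (α : ℂ) := by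
  rcases eq_or_ne z 0 with rfl | hz
  · simp [Complex.zero_cpow (show (α : ℂ) ≠ 0 by exact_mod_cast hα.ne')]
  · have hh' : (h : ℂ) ≠ 0 := by exact_mod_cast hh.ne'
    rw [Complex.cpow_def_of_ne_zero (mul_ne_zero hh' hz), Complex.log_ofReal_mul hh hz,
      Complex.cpow_def_of_ne_zero hz, add_mul, Complex.exp_add, Real.rpow_def_of_pos hh]
    push_cast
    rfl

/-- The scale `h = (c / n) ^ α⁻¹` satisfies `n h ^ α = c`, and `(1 - exp (w h)) / h → -w`, so `n (1
- exp (w h)) ^ α → c (-w) ^ α`. Imaginary `w` gives characteristic functions, negative real `w`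
Laplace transforms. -/
lemma tendsto_sibuya_pow {α c : ℝ} (h0 : 0 < α) (hc : 0 < c) {w : ℂ} (hw : -w ∈ Complex.slitPlane) :
    Tendsto (fun n : ℕ ↦
      (1 - (1 - Complex.exp (w * ((c / n) ^ α⁻¹ : ℝ))) ^ (α : ℂ)) ^ n) atTop
      (𝓝 (Complex.exp (-(c * (-w) ^ (α : ℂ))))) := by
  have hh : Tendsto (fun n : ℕ ↦ (c / n) ^ α⁻¹) atTop (𝓝 0) := by
    have := (tendsto_const_div_atTop_nhds_zero_nat c).rpow_const (p := α⁻¹)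
      (Or.inr (inv_nonneg.2 h0.le))
    rwa [Real.zero_rpow (inv_ne_zero h0.ne')] at this
  have hpos : ∀ᶠ n : ℕ in atTop, 0 < (c / n) ^ α⁻¹ := by
    filter_upwards [eventually_gt_atTop 0] with n hn
    have : (0 : ℝ) < n := by exact_mod_cast hn
    positivity
  have hder : HasDerivAt (fun x : ℝ ↦ 1 - Complex.exp (w * x)) (-w) 0 := by
    have h1 : HasDerivAt (fun z : ℂ ↦ 1 - Complex.exp (w * z)) (-w) ((0 : ℝ) : ℂ) := by
      have := (((hasDerivAt_id ((0 : ℝ) : ℂ)).const_mul w).cexp).const_sub 1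
      simpa using this
    exact h1.comp_ofReal
  have hslope : Tendsto (fun n : ℕ ↦ (((c / n) ^ α⁻¹ : ℝ) : ℂ)⁻¹ *
      (1 - Complex.exp (w * ((c / n) ^ α⁻¹ : ℝ)))) atTop (𝓝 (-w)) := by
    have h2 := (hasDerivAt_iff_tendsto_slope_zero.1 hder).comp
      (tendsto_nhdsWithin_iff.2 ⟨hh, hpos.mono fun n hn ↦ hn.ne'⟩)
    refine h2.congr fun n ↦ ?_
    simp [Complex.real_smul]
  have hlim := (continuousAt_cpow_const (b := (α : ℂ)) hw).tendsto.comp hslope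
  have hg : Tendsto (fun n : ℕ ↦
      (n : ℂ) * (-(1 - Complex.exp (w * ((c / n) ^ α⁻¹ : ℝ))) ^ (α : ℂ))) atTop
      (𝓝 (-(c * (-w) ^ (α : ℂ)))) := by
    refine ((hlim.const_mul (c : ℂ)).neg).congr' ?_
    filter_upwards [hpos, eventually_gt_atTop 0] with n hn hn0
    have hn' : (n : ℝ) ≠ 0 := by exact_mod_cast hn0.ne'
    have hnc : (n : ℂ) ≠ 0 := by exact_mod_cast hn0.ne'
    have hhc : (((c / n) ^ α⁻¹ : ℝ) : ℂ) ≠ 0 := by exact_mod_cast hn.ne'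
    have e1 : ((c / n) ^ α⁻¹) ^ α = c / n := Real.rpow_inv_rpow (by positivity) h0.ne'
    have e2 := Complex.ofReal_mul_cpow_ofReal hn h0
      ((((c / n) ^ α⁻¹ : ℝ) : ℂ)⁻¹ * (1 - Complex.exp (w * ((c / n) ^ α⁻¹ : ℝ))))
    rw [mul_inv_cancel_left₀ hhc, e1] at e2
    rw [e2]
    simp only [Function.comp_apply]
    push_cast
    field_simp
  simpa only [← sub_eq_add_neg] using Complex.tendsto_one_add_pow_exp_of_tendsto hg

/-- Since `-it = |t| exp (∓iπ/2)`, its principal power is `|t| ^ α exp (∓iπα/2)`; dividing by the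
cosine leaves `1 ∓ i tan (πα/2)`. This fixes the value of `c`. -/
lemma charFun_maxSkewedStable_exponent {α : ℝ} (h0 : 0 < α) (h1 : α < 1) {t : ℝ} (ht : t ≠ 0) :
    (((Real.cos (Real.pi * α / 2))⁻¹ : ℝ) : ℂ) * (-(t * Complex.I)) ^ (α : ℂ) =
      ((|t| ^ α : ℝ) : ℂ) *
        (1 - Complex.I * ((Real.sign t * Real.tan (Real.pi * α / 2) : ℝ) : ℂ)) := by
  have hcos : 0 < Real.cos (Real.pi * α / 2) :=
    Real.cos_pos_of_mem_Ioo ⟨by nlinarith [Real.pi_pos], by nlinarith [Real.pi_pos]⟩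
  have hcosc : (Real.cos (Real.pi * α / 2) : ℂ) ≠ 0 := by exact_mod_cast hcos.ne'
  have e : -((t : ℂ) * Complex.I) = ((|t| : ℝ) : ℂ) * (-(Real.sign t : ℂ) * Complex.I) := by
    rcases lt_or_gt_of_ne ht with h | h
    · rw [abs_of_neg h, Real.sign_of_neg h]; push_cast; ring
    · rw [abs_of_pos h, Real.sign_of_pos h]; push_cast; ring
  rw [e, Complex.ofReal_mul_cpow_ofReal (abs_pos.2 ht) h0, Real.tan_eq_sin_div_cos]
  have key : (-(Real.sign t : ℂ) * Complex.I) ^ (α : ℂ) = Real.cos (Real.pi * α / 2)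
      - Complex.I * Real.sign t * Real.sin (Real.pi * α / 2) := by
    rcases lt_or_gt_of_ne ht with h | h
    · rw [Real.sign_of_neg h, Complex.cpow_def_of_ne_zero (by simp)]
      have : Complex.log (-((-1 : ℝ) : ℂ) * Complex.I) * α =
          ((Real.pi * α / 2 : ℝ) : ℂ) * Complex.I := by
        simp [Complex.log_I]; ring
      rw [this, Complex.exp_mul_I, ← Complex.ofReal_cos, ← Complex.ofReal_sin]
      push_cast; ring
    · rw [Real.sign_of_pos h, Complex.cpow_def_of_ne_zero (by simp)]
      have : Complex.log (-((1 : ℝ) : ℂ) * Complex.I) * α =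
          ((-(Real.pi * α / 2) : ℝ) : ℂ) * Complex.I := by
        simp [Complex.log_neg_I]; ring
      rw [this, Complex.exp_mul_I, ← Complex.ofReal_cos, ← Complex.ofReal_sin, Real.cos_neg,
        Real.sin_neg]
      push_cast; ring
  rw [key]
  push_cast at hcosc ⊢
  field_simp

/-! ### Positivity and Laplace transform of the stable law -/

section
variable {α : ℝ} {μ : Measure ℝ} [IsProbabilityMeasure μ]

lemma SparseCC.IsMaxSkewedStable.exists_tendsto (h : SparseCC.IsMaxSkewedStable α μ)
    (h0 : 0 < α) (h1 : α < 1) :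
    ∃ ν : ℕ → ProbabilityMeasure ℝ, Tendsto ν atTop (𝓝 ⟨μ, inferInstance⟩) ∧
      (∀ n, (ν n : Measure ℝ) (Set.Iio 0) = 0) ∧
      ∀ l : ℝ, 0 < l → Tendsto (fun n ↦ ∫ x, Real.exp (-l * x) ∂(ν n : Measure ℝ)) atTop
        (𝓝 (Real.exp (-((Real.cos (Real.pi * α / 2))⁻¹ * l ^ α)))) := by
  have hcos : 0 < Real.cos (Real.pi * α / 2) :=
    Real.cos_pos_of_mem_Ioo ⟨by nlinarith [Real.pi_pos], by nlinarith [Real.pi_pos]⟩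
  have hc : 0 < (Real.cos (Real.pi * α / 2))⁻¹ := inv_pos.2 hcos
  set c := (Real.cos (Real.pi * α / 2))⁻¹ with hc_def
  choose ν hν0 hν using fun n : ℕ ↦
    exists_scaled_sum_law h0 h1 (h := (c / n) ^ α⁻¹) (by positivity) n
  refine ⟨ν, ProbabilityMeasure.tendsto_of_tendsto_charFun fun t ↦ ?_, hν0, fun l hl ↦ ?_⟩
  · rcases eq_or_ne t 0 with rfl | ht
    · simp
    · change Tendsto _ _ (𝓝 (charFun μ t))
      rw [h t, neg_mul, ← charFun_maxSkewedStable_exponent h0 h1 ht]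
      refine (tendsto_sibuya_pow h0 hc (w := t * Complex.I)
        (Or.inr (by simpa using ht))).congr fun n ↦ ?_
      rw [← hν n _ (by simp), charFun_apply_real]
      exact integral_congr_ae (.of_forall fun x ↦ by ring_nf)
  · have := tendsto_sibuya_pow h0 hc (w := ((-l : ℝ) : ℂ)) (by
      rw [← Complex.ofReal_neg, neg_neg]; exact Complex.ofReal_mem_slitPlane.2 hl)
    have e : ∀ n : ℕ, (1 - (1 - Complex.exp (((-l : ℝ) : ℂ) * ((c / n) ^ α⁻¹ : ℝ))) ^ (α : ℂ)) ^ n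
        = ((∫ x, Real.exp (-l * x) ∂(ν n : Measure ℝ) : ℝ) : ℂ) := by
      intro n
      rw [← hν n _ (by simpa using hl.le), ← integral_complex_ofReal]
      refine integral_congr_ae (.of_forall fun x ↦ ?_)
      push_cast
      rfl
    simp_rw [e] at this
    have e2 : Complex.exp (-(c * (-((-l : ℝ) : ℂ)) ^ (α : ℂ))) = (Real.exp (-(c * l ^ α)) : ℂ) := by
      rw [← Complex.ofReal_neg, neg_neg, ← Complex.ofReal_cpow hl.le]
      push_cast
      rfl
    rw [e2] at this
    exact (Complex.continuous_re.tendsto _).comp this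

/-- Portmanteau on an open half-line that every approximating law misses. -/
lemma SparseCC.IsMaxSkewedStable.measure_Iio_zero (h : SparseCC.IsMaxSkewedStable α μ)
    (h0 : 0 < α) (h1 : α < 1) : μ (Set.Iio 0) = 0 := by
  obtain ⟨ν, hν, hν0, -⟩ := h.exists_tendsto h0 h1
  have := ProbabilityMeasure.le_liminf_measure_open_of_tendsto hν (isOpen_Iio (a := (0 : ℝ)))
  simpa [hν0] using this

lemma SparseCC.IsMaxSkewedStable.integral_exp (h : SparseCC.IsMaxSkewedStable α μ)
    (h0 : 0 < α) (h1 : α < 1) {l : ℝ} (hl : 0 < l) :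
    ∫ x, Real.exp (-l * x) ∂μ = Real.exp (-((Real.cos (Real.pi * α / 2))⁻¹ * l ^ α)) := by
  obtain ⟨ν, hν, hν0, hlim⟩ := h.exists_tendsto h0 h1
  have key : ∀ m : Measure ℝ, m (Set.Iio 0) = 0 →
      ∫ x, Real.exp (-l * max x 0) ∂m = ∫ x, Real.exp (-l * x) ∂m := by
    intro m hm
    refine integral_congr_ae ?_
    have : ∀ᵐ x ∂m, x ∉ Set.Iio (0 : ℝ) := measure_eq_zero_iff_ae_notMem.1 hm
    filter_upwards [this] with x hx
    rw [max_eq_left (by simpa using hx)]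
  -- Replacing `x` by `max x 0` makes the exponential a bounded test function for weak convergence,
  -- without changing integrals against laws on `[0,∞)`.
  let f : BoundedContinuousFunction ℝ ℝ := BoundedContinuousFunction.ofNormedAddCommGroup
    (fun x ↦ Real.exp (-l * max x 0)) (by fun_prop) 1 (fun x ↦ by
      rw [Real.norm_of_nonneg (Real.exp_pos _).le, Real.exp_le_one_iff]
      nlinarith [le_max_right x 0])
  have l1 := ProbabilityMeasure.tendsto_iff_forall_integral_tendsto.1 hν f
  rw [← key μ (h.measure_Iio_zero h0 h1)]
  refine tendsto_nhds_unique l1 ((hlim l hl).congr fun n ↦ ?_)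
  exact (key _ (hν0 n)).symm

/-- An atom at `0` would bound the Laplace transform from below, but the transform tends to `0` as
`l → ∞`. -/
lemma SparseCC.IsMaxSkewedStable.measure_Iic_zero (h : SparseCC.IsMaxSkewedStable α μ)
    (h0 : 0 < α) (h1 : α < 1) : μ (Set.Iic 0) = 0 := by
  have hcos : 0 < Real.cos (Real.pi * α / 2) :=
    Real.cos_pos_of_mem_Ioo ⟨by nlinarith [Real.pi_pos], by nlinarith [Real.pi_pos]⟩
  have hae : ∀ᵐ x ∂μ, 0 ≤ x := by
    filter_upwards [measure_eq_zero_iff_ae_notMem.1 (h.measure_Iio_zero h0 h1)] with x hx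
    simpa using hx
  have hbound : ∀ l : ℝ, 0 < l → μ.real (Set.Iic 0) ≤
      Real.exp (-((Real.cos (Real.pi * α / 2))⁻¹ * l ^ α)) := by
    intro l hl
    rw [← h.integral_exp h0 h1 hl, ← integral_indicator_one measurableSet_Iic]
    refine integral_mono_ae ((integrable_const (1 : ℝ)).indicator measurableSet_Iic) ?_ ?_
    · refine Integrable.of_bound (by fun_prop) 1 ?_
      filter_upwards [hae] with x hx
      rw [Real.norm_of_nonneg (Real.exp_pos _).le, Real.exp_le_one_iff]
      nlinarith
    · filter_upwards [hae] with x hx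
      by_cases hx0 : x ≤ 0
      · have : x = 0 := le_antisymm hx0 hx
        simp [this]
      · simp [hx0, Real.exp_nonneg]
  have hlim : Tendsto (fun l : ℝ ↦ Real.exp (-((Real.cos (Real.pi * α / 2))⁻¹ * l ^ α))) atTop
      (𝓝 0) :=
    Real.tendsto_exp_neg_atTop_nhds_zero.comp
      ((tendsto_rpow_atTop h0).const_mul_atTop (inv_pos.2 hcos))
  have : μ.real (Set.Iic 0) ≤ 0 := ge_of_tendsto hlim (by
    filter_upwards [eventually_gt_atTop 0] with l hl using hbound l hl)
  exact (measureReal_eq_zero_iff).1 (le_antisymm this measureReal_nonneg)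

end

/-! ### Mean of the ratio `Z / (Y + Z)` through Laplace transforms -/

section
variable {Ω : Type*} [MeasurableSpace Ω] {P : Measure Ω} [IsProbabilityMeasure P] {Y Z : Ω → ℝ}

lemma integrable_exp_neg_mul_of_nonneg (hY : Measurable Y) (hY0 : ∀ᵐ ω ∂P, 0 ≤ Y ω) {l : ℝ}
    (hl : 0 ≤ l) : Integrable (fun ω ↦ Real.exp (-l * Y ω)) P := by
  refine Integrable.of_bound (by fun_prop) 1 ?_
  filter_upwards [hY0] with ω h
  rw [Real.norm_of_nonneg (Real.exp_pos _).le, Real.exp_le_one_iff]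
  nlinarith

/-- The first moment of a nonnegative variable tilted by `exp (-l Z)`, when its Laplace transform
is `exp (-b l ^ α)`. -/
lemma integral_mul_exp_of_laplace (hZ : Measurable Z) (hZ0 : ∀ᵐ ω ∂P, 0 ≤ Z ω) {α b : ℝ}
    (hL : ∀ l : ℝ, 0 < l → ∫ ω, Real.exp (-l * Z ω) ∂P = Real.exp (-(b * l ^ α))) {l : ℝ}
    (hl : 0 < l) :
    ∫ ω, Z ω * Real.exp (-l * Z ω) ∂P = b * (α * l ^ (α - 1)) * Real.exp (-(b * l ^ α)) := by
  have hsub : Set.Iio 0 ⊆ integrableExpSet Z P := by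
    intro t ht
    have := integrable_exp_neg_mul_of_nonneg hZ hZ0 (l := -t) (by simpa using (Set.mem_Iio.1 ht).le)
    simpa [integrableExpSet] using this
  have hint : -l ∈ interior (integrableExpSet Z P) :=
    interior_mono hsub (by simpa [isOpen_Iio.interior_eq] using hl)
  -- The tilted moment is minus the derivative of the Laplace transform, computed in two ways.
  have h1 := (hasDerivAt_mgf hint).scomp l (hasDerivAt_neg l)
  have h2 : HasDerivAt (fun l : ℝ ↦ Real.exp (-(b * l ^ α)))
      (Real.exp (-(b * l ^ α)) * (-(b * (α * l ^ (α - 1))))) l :=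
    ((Real.hasDerivAt_rpow_const (Or.inl hl.ne')).const_mul b).neg.exp
  have heq : (mgf Z P ∘ fun x ↦ -x) =ᶠ[𝓝 l] fun l : ℝ ↦ Real.exp (-(b * l ^ α)) := by
    filter_upwards [eventually_gt_nhds hl] with m hm
    exact hL m hm
  have := h1.unique (h2.congr_of_eventuallyEq heq)
  simp only [smul_eq_mul, neg_mul, one_mul, neg_inj, mul_neg] at this
  simp only [neg_mul]
  rw [this]
  ring

/-- Write `Z / (Y + Z)` as the integral of `Z exp (-l (Y + Z))` over `l > 0`, swap by Tonelli, and
factor by independence. -/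
lemma lintegral_div_add_eq (hY : Measurable Y) (hZ : Measurable Z) (hYZ : IndepFun Z Y P)
    (hY0 : ∀ᵐ ω ∂P, 0 ≤ Y ω) (hZ0 : ∀ᵐ ω ∂P, 0 < Z ω) :
    ∫⁻ ω, ENNReal.ofReal (Z ω / (Y ω + Z ω)) ∂P =
      ∫⁻ l in Set.Ioi (0 : ℝ), ENNReal.ofReal
        ((∫ ω, Z ω * Real.exp (-l * Z ω) ∂P) * ∫ ω, Real.exp (-l * Y ω) ∂P) := by
  have e1 : ∀ᵐ ω ∂P, ENNReal.ofReal (Z ω / (Y ω + Z ω)) =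
      ∫⁻ l in Set.Ioi (0 : ℝ),
        ENNReal.ofReal ((Z ω * Real.exp (-l * Z ω)) * Real.exp (-l * Y ω)) := by
    filter_upwards [hY0, hZ0] with ω h1 h2
    have hs : -(Y ω + Z ω) < 0 := by linarith
    have e : ∀ l : ℝ, (Z ω * Real.exp (-l * Z ω)) * Real.exp (-l * Y ω)
        = Z ω * Real.exp (-(Y ω + Z ω) * l) := by
      intro l
      rw [mul_assoc, ← Real.exp_add]
      ring_nf
    simp_rw [e]
    rw [← ofReal_integral_eq_lintegral_ofReal ((integrableOn_exp_mul_Ioi hs 0).const_mul _)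
      (.of_forall fun l ↦ by positivity), integral_const_mul, integral_exp_mul_Ioi hs]
    congr 1
    rw [mul_zero, Real.exp_zero, neg_div_neg_eq, mul_one_div]
  rw [lintegral_congr_ae e1, lintegral_lintegral_swap
    (f := fun ω l ↦ ENNReal.ofReal ((Z ω * Real.exp (-l * Z ω)) * Real.exp (-l * Y ω)))
    (by fun_prop)]
  refine setLIntegral_congr_fun measurableSet_Ioi fun l hl ↦ ?_
  have hl : 0 < l := hl
  have hind : IndepFun (fun ω ↦ Z ω * Real.exp (-l * Z ω)) (fun ω ↦ Real.exp (-l * Y ω)) P :=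
    hYZ.comp (φ := fun z ↦ z * Real.exp (-l * z)) (ψ := fun y ↦ Real.exp (-l * y))
      (by fun_prop) (by fun_prop)
  have hbd : Integrable (fun ω ↦ Z ω * Real.exp (-l * Z ω)) P := by
    refine Integrable.of_bound (by fun_prop) l⁻¹ ?_
    filter_upwards [hZ0] with ω h
    rw [Real.norm_of_nonneg (by positivity), neg_mul, Real.exp_neg, ← div_eq_mul_inv,
      div_le_iff₀ (Real.exp_pos _), inv_mul_eq_div, le_div_iff₀ hl]
    linarith [Real.add_one_le_exp (l * Z ω)]
  have hbd2 := integrable_exp_neg_mul_of_nonneg hY hY0 hl.le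
  rw [← hind.integral_fun_mul_eq_mul_integral hbd.aestronglyMeasurable hbd2.aestronglyMeasurable]
  refine (ofReal_integral_eq_lintegral_ofReal (hind.integrable_mul hbd hbd2) ?_).symm
  · filter_upwards [hZ0] with ω h
    simp only [Pi.zero_apply, Pi.mul_apply]
    positivity

lemma integral_le_integral_div_add (hY : Measurable Y) (hZ : Measurable Z) (hYZ : IndepFun Z Y P)
    (hY0 : ∀ᵐ ω ∂P, 0 ≤ Y ω) (hZ0 : ∀ᵐ ω ∂P, 0 < Z ω) {g : ℝ → ℝ}
    (hg0 : ∀ l ∈ Set.Ioi (0 : ℝ), 0 ≤ g l) (hgi : IntegrableOn g (Set.Ioi 0))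
    (hg : ∀ l ∈ Set.Ioi (0 : ℝ),
      g l ≤ (∫ ω, Z ω * Real.exp (-l * Z ω) ∂P) * ∫ ω, Real.exp (-l * Y ω) ∂P) :
    ∫ l in Set.Ioi (0 : ℝ), g l ≤ ∫ ω, Z ω / (Y ω + Z ω) ∂P := by
  have hnn : ∀ᵐ ω ∂P, 0 ≤ Z ω / (Y ω + Z ω) := by
    filter_upwards [hY0, hZ0] with ω h1 h2
    positivity
  rw [integral_eq_lintegral_of_nonneg_ae (ae_restrict_of_forall_mem measurableSet_Ioi hg0)
    hgi.aestronglyMeasurable, integral_eq_lintegral_of_nonneg_ae hnn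
    (hZ.div (hY.add hZ)).aestronglyMeasurable, lintegral_div_add_eq hY hZ hYZ hY0 hZ0]
  refine ENNReal.toReal_mono ?_ (setLIntegral_mono' measurableSet_Ioi
    fun l hl ↦ ENNReal.ofReal_le_ofReal (hg l hl))
  rw [← lintegral_div_add_eq hY hZ hYZ hY0 hZ0]
  refine ne_top_of_le_ne_top ENNReal.one_ne_top ?_
  calc ∫⁻ ω, ENNReal.ofReal (Z ω / (Y ω + Z ω)) ∂P ≤ ∫⁻ _, 1 ∂P := by
        refine lintegral_mono_ae ?_
        filter_upwards [hY0, hZ0] with ω h1 h2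
        rw [← ENNReal.ofReal_one]
        refine ENNReal.ofReal_le_ofReal ((div_le_one (by positivity)).2 (by linarith))
    _ = 1 := by simp

/-- The substitution `v = exp (-ρ l ^ α)` reduces the integral to that of `(1 - γ + γ v) ^ n` over
`[0, 1]`; in particular `α` and `ρ` drop out. -/
lemma integral_Ioi_binomial_exp {α ρ γ : ℝ} (hα : 0 < α) (hρ : 0 < ρ) (hγ : 0 < γ) (hγ1 : γ ≤ 1)
    (n : ℕ) :
    let g := fun l : ℝ ↦ ρ * (α * l ^ (α - 1)) * Real.exp (-(ρ * l ^ α)) *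
      (1 - γ + γ * Real.exp (-(ρ * l ^ α))) ^ n
    IntegrableOn g (Set.Ioi 0) ∧
      ∫ l in Set.Ioi (0 : ℝ), g l = (1 - (1 - γ) ^ (n + 1)) / ((n + 1) * γ) := by
  intro g
  let G : ℝ → ℝ := fun l ↦ -(1 / ((n + 1) * γ)) * (1 - γ + γ * Real.exp (-(ρ * l ^ α))) ^ (n + 1)
  have hcont : ContinuousWithinAt G (Set.Ici 0) 0 := by
    have : Continuous G := by
      have := Real.continuous_rpow_const hα.le
      fun_prop
    exact this.continuousWithinAt
  have hder : ∀ l ∈ Set.Ioi (0 : ℝ), HasDerivAt G (g l) l := by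
    intro l hl
    have hl : 0 < l := hl
    have h := ((((((Real.hasDerivAt_rpow_const (p := α) (Or.inl hl.ne')).const_mul ρ).neg.exp
      ).const_mul γ).const_add (1 - γ)).pow (n + 1)).const_mul (-(1 / ((n + 1) * γ)))
    refine h.congr_deriv ?_
    have : ((n : ℝ) + 1) ≠ 0 := by positivity
    simp only [g]
    push_cast [add_tsub_cancel_right]
    field_simp
    rfl
  have hpos : ∀ l ∈ Set.Ioi (0 : ℝ), 0 ≤ g l := by
    intro l hl
    have hl : 0 < l := hl
    have : 0 ≤ 1 - γ := by linarith
    simp only [g]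
    positivity
  have hlim : Tendsto G atTop (𝓝 (-(1 / ((n + 1) * γ)) * (1 - γ + γ * 0) ^ (n + 1))) := by
    have : Tendsto (fun l : ℝ ↦ Real.exp (-(ρ * l ^ α))) atTop (𝓝 0) :=
      Real.tendsto_exp_neg_atTop_nhds_zero.comp ((tendsto_rpow_atTop hα).const_mul_atTop hρ)
    exact (((this.const_mul γ).const_add (1 - γ)).pow (n + 1)).const_mul _
  refine ⟨integrableOn_Ioi_deriv_of_nonneg hcont hder hpos hlim, ?_⟩
  rw [integral_Ioi_of_hasDerivAt_of_nonneg hcont hder hpos hlim]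
  have : ((n : ℝ) + 1) ≠ 0 := by positivity
  simp only [G, Real.zero_rpow hα.ne', mul_zero, neg_zero, Real.exp_zero, mul_one, add_zero,
    sub_add_cancel, one_pow]
  field_simp
  ring

/-- Markov's inequality for `Y / (Y + κ S)`. -/
lemma one_sub_le_measureReal_le_mul (hY : Measurable Y) (hZ : Measurable Z)
    (hY0 : ∀ᵐ ω ∂P, 0 ≤ Y ω) (hZ0 : ∀ᵐ ω ∂P, 0 < Z ω) {ε κ : ℝ} (hε : 0 < ε) (hκ : 0 < κ) :
    1 - (1 + κ / ε) * (1 - ∫ ω, κ * Z ω / (Y ω + κ * Z ω) ∂P) ≤ P.real {ω | Y ω ≤ ε * Z ω} := by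
  have hm : MeasurableSet {ω | Y ω ≤ ε * Z ω} := measurableSet_le hY (by fun_prop)
  have hint : Integrable (fun ω ↦ κ * Z ω / (Y ω + κ * Z ω)) P := by
    refine Integrable.of_bound (Measurable.aestronglyMeasurable (by fun_prop)) 1 ?_
    filter_upwards [hY0, hZ0] with ω h1 h2
    rw [Real.norm_of_nonneg (by positivity)]
    exact (div_le_one (by positivity)).2 (by linarith)
  have e : 1 - (1 + κ / ε) * (1 - ∫ ω, κ * Z ω / (Y ω + κ * Z ω) ∂P) =
      ∫ ω, (1 - (1 + κ / ε) * (1 - κ * Z ω / (Y ω + κ * Z ω))) ∂P := by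
    have h1 : Integrable (fun ω ↦ 1 - κ * Z ω / (Y ω + κ * Z ω)) P :=
      (integrable_const 1).sub hint
    rw [integral_sub (integrable_const 1) (h1.const_mul _), integral_const_mul,
      integral_sub (integrable_const 1) hint]
    simp
  rw [e, ← integral_indicator_one hm]
  refine integral_mono_ae ((integrable_const _).sub (((integrable_const _).sub hint).const_mul _))
    ((integrable_const (1 : ℝ)).indicator hm) ?_
  filter_upwards [hY0, hZ0] with ω h1 h2
  have hpos : 0 < Y ω + κ * Z ω := by positivity
  have e2 : 1 - κ * Z ω / (Y ω + κ * Z ω) = Y ω / (Y ω + κ * Z ω) := by field_simp; ring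
  simp only [e2]
  -- Off the event, `Y / (Y + κ Z)` is at least `ε / (ε + κ)`, the reciprocal of `1 + κ / ε`.
  by_cases h : Y ω ≤ ε * Z ω
  · rw [Set.indicator_of_mem (by exact h)]
    have : 0 ≤ (1 + κ / ε) * (Y ω / (Y ω + κ * Z ω)) := by positivity
    simp only [Pi.one_apply]
    linarith
  · rw [Set.indicator_of_notMem (by exact h), sub_nonpos]
    push Not at h
    rw [show (1 + κ / ε) * (Y ω / (Y ω + κ * Z ω)) = ((ε + κ) * Y ω) / (ε * (Y ω + κ * Z ω)) by
      field_simp, le_div_iff₀ (by positivity)]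
    nlinarith

end

/-! ### Independence of groups of variables -/

section
variable {Ω : Type*}

lemma measurable_biSup_comap {ι : Type*} (f : ι → Ω → ℝ) {S : Set ι} {i : ι} (hi : i ∈ S) :
    Measurable[⨆ i ∈ S, MeasurableSpace.comap (f i) inferInstance] (f i) :=
  (comap_measurable (f i)).mono
    (le_biSup (fun i ↦ MeasurableSpace.comap (f i) inferInstance) hi) le_rfl

variable [MeasurableSpace Ω] {P : Measure Ω}

lemma iIndep.iIndepFun_of_measurable {κ : Type*} {m : κ → MeasurableSpace Ω} (hm : iIndep m P)
    {X : κ → Ω → ℝ} (hX : ∀ k, Measurable[m k] (X k)) : iIndepFun X P := by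
  rw [iIndepFun, Kernel.iIndepFun, ← iIndep, iIndep_iff]
  exact fun T A hA ↦ (iIndep_iff _ _).1 hm T fun i hi ↦ (hX i).comap_le _ (hA i hi)

lemma Indep.indepFun_of_measurable {m₁ m₂ : MeasurableSpace Ω} (h : Indep m₁ m₂ P)
    {β γ : Type*} [MeasurableSpace β] [MeasurableSpace γ] {X : Ω → β} {Y : Ω → γ}
    (hX : Measurable[m₁] X) (hY : Measurable[m₂] Y) : IndepFun X Y P :=
  indep_of_indep_of_le_left (indep_of_indep_of_le_right h hY.comap_le) hX.comap_le

end

section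
variable {Ω : Type*} [mΩ : MeasurableSpace Ω] {P : Measure Ω} [IsProbabilityMeasure P]

/-- Disjoint groups of independent variables generate independent `σ`-algebras. -/
lemma iIndepFun.iIndep_biSup {ι κ : Type*} {f : ι → Ω → ℝ} (hf : iIndepFun f P)
    (hfm : ∀ i, Measurable (f i)) {S : κ → Set ι} (hS : Pairwise fun j k ↦ Disjoint (S j) (S k)) :
    iIndep (fun j ↦ ⨆ i ∈ S j, MeasurableSpace.comap (f i) inferInstance) P := by
  classical
  rw [iIndep_iff]
  intro T
  induction T using Finset.induction_on with
  | empty => intro A _; simp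
  | insert a T ha ih =>
    intro A hA
    rw [Finset.set_biInter_insert, Finset.prod_insert ha,
      ← ih fun i hi ↦ hA i (Finset.mem_insert_of_mem hi)]
    have hdis : Disjoint (S a) (⋃ j ∈ T, S j) := by
      simp only [Set.disjoint_iUnion_right]
      exact fun j hj ↦ hS (by rintro rfl; exact ha hj)
    refine (Indep_iff _ _ _).1 (indep_iSup_of_disjoint (fun i ↦ (hfm i).comap_le) hf hdis) _ _
      (hA a (Finset.mem_insert_self _ _)) ?_
    refine Finset.measurableSet_biInter _ fun j hj ↦ ?_
    refine (biSup_mono fun i hi ↦ ?_ : (⨆ i ∈ S j, MeasurableSpace.comap (f i) inferInstance) ≤ _)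
      _ (hA j (Finset.mem_insert_of_mem hj))
    exact Set.mem_biUnion hj hi

/-! ### A single measurement -/

/-- As `R` is almost surely `0` or `1`, `exp (-l S R) = (1 - R) + R exp (-l S)`, which is affine in
`R`. -/
lemma mgf_mul_bernoulli {S R : Ω → ℝ} {γ : unitInterval} (hS : Measurable S) (hR : Measurable R)
    (hSR : IndepFun S R P) (hlaw : P.map R = bernoulliMeasure (1 : ℝ) 0 γ)
    (hS0 : ∀ᵐ ω ∂P, 0 ≤ S ω) {l : ℝ} (hl : 0 ≤ l) :
    mgf (fun ω ↦ S ω * R ω) P (-l) = 1 - γ + γ * mgf S P (-l) := by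
  have hR01 : ∀ᵐ ω ∂P, R ω = 1 ∨ R ω = 0 := by
    have : ∀ᵐ x ∂(P.map R), x = 1 ∨ x = 0 := by
      rw [hlaw, bernoulliMeasure_def, ae_add_measure_iff]
      constructor
      · exact Measure.ae_smul_measure (by simp [ae_dirac_eq]) _
      · exact Measure.ae_smul_measure (by simp [ae_dirac_eq]) _
    exact ae_of_ae_map hR.aemeasurable this
  have hER : ∫ ω, R ω ∂P = γ := by
    have := integral_map hR.aemeasurable (f := fun x : ℝ ↦ x) (μ := P) (by fun_prop)
    rw [← this, hlaw, integral_bernoulliMeasure]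
    simp
  have hRi : Integrable R P := by
    refine Integrable.of_bound hR.aestronglyMeasurable 1 ?_
    filter_upwards [hR01] with ω h
    rcases h with h | h <;> simp [h]
  have hE := integrable_exp_neg_mul_of_nonneg hS hS0 hl
  have hind : IndepFun R (fun ω ↦ Real.exp (-l * S ω)) P :=
    hSR.symm.comp (φ := id) (ψ := fun x ↦ Real.exp (-l * x)) measurable_id (by fun_prop)
  have e : ∀ᵐ ω ∂P, Real.exp (-l * (S ω * R ω)) = (1 - R ω) + R ω * Real.exp (-l * S ω) := by
    filter_upwards [hR01] with ω h
    rcases h with h | h <;> simp [h]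
  have h1 : Integrable (fun ω ↦ 1 - R ω) P := (integrable_const 1).sub hRi
  have h2 : Integrable (fun ω ↦ R ω * Real.exp (-l * S ω)) P := hind.integrable_mul hRi hE
  simp only [mgf]
  rw [integral_congr_ae e, integral_add h1 h2, integral_sub (integrable_const 1) hRi,
    hind.integral_fun_mul_eq_mul_integral hRi.aestronglyMeasurable hE.aestronglyMeasurable, hER]
  simp

variable {N : ℕ} {α : ℝ} {γ : unitInterval} {s r : Fin N → Ω → ℝ}

/-- Probability that one measurement determines the `i`-th coordinate up to `ε`. -/
lemma le_measureReal_informative (h0 : 0 < α) (h1 : α < 1) (hγ : 0 < γ)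
    (hs : ∀ t, Measurable (s t)) (hr : ∀ t, Measurable (r t))
    (hls : ∀ t, SparseCC.IsMaxSkewedStable α (P.map (s t)))
    (hlr : ∀ t, P.map (r t) = bernoulliMeasure (1 : ℝ) 0 γ)
    (hind : iIndepFun (Sum.elim s r) P) {x : Fin N → ℝ} (hx : ∀ t, 0 ≤ x t) (i : Fin N)
    {ε κ θ : ℝ} (hε : 0 < ε) (hκ : 0 < κ) (hθ : 1 ≤ θ)
    (hθx : ∀ t, x t ≠ 0 → x t ^ α ≤ θ * κ ^ α) {n : ℕ}
    (hn : ((Finset.univ.erase i).filter fun t ↦ x t ≠ 0).card = n) :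
    (γ : ℝ) * (1 - (1 + κ / ε) * (1 - θ⁻¹ * ((1 - (1 - γ) ^ (n + 1)) / ((n + 1) * γ)))) ≤
      P.real {ω | r i ω = 1 ∧ ∑ t ∈ Finset.univ.erase i, x t * (s t ω * r t ω) ≤ ε * s i ω} := by
  have hγ' : (0 : ℝ) < γ := hγ
  have hγ1 : (γ : ℝ) ≤ 1 := γ.2.2
  have hfm : ∀ p, Measurable (Sum.elim s r p) := by rintro (t | t) <;> simp [hs, hr]
  have hprob : ∀ t, IsProbabilityMeasure (P.map (s t)) := fun t ↦
    Measure.isProbabilityMeasure_map (hs t).aemeasurable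
  have hcos : 0 < Real.cos (Real.pi * α / 2) :=
    Real.cos_pos_of_mem_Ioo ⟨by nlinarith [Real.pi_pos], by nlinarith [Real.pi_pos]⟩
  have hc : 0 < (Real.cos (Real.pi * α / 2))⁻¹ := inv_pos.2 hcos
  set c := (Real.cos (Real.pi * α / 2))⁻¹ with hc_def
  have hs0 : ∀ t, ∀ᵐ ω ∂P, 0 < s t ω := by
    intro t
    have : ∀ᵐ y ∂(P.map (s t)), 0 < y := by
      filter_upwards [measure_eq_zero_iff_ae_notMem.1 ((hls t).measure_Iic_zero h0 h1)] with y hy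
      simpa using hy
    exact ae_of_ae_map (hs t).aemeasurable this
  have hr0 : ∀ t, ∀ᵐ ω ∂P, 0 ≤ r t ω := by
    intro t
    have : ∀ᵐ y ∂(P.map (r t)), 0 ≤ y := by
      rw [hlr, bernoulliMeasure_def, ae_add_measure_iff]
      constructor
      · exact Measure.ae_smul_measure (by simp [ae_dirac_eq]) _
      · exact Measure.ae_smul_measure (by simp [ae_dirac_eq]) _
    exact ae_of_ae_map (hr t).aemeasurable this
  have hL : ∀ t, ∀ l : ℝ, 0 < l → ∫ ω, Real.exp (-l * s t ω) ∂P = Real.exp (-(c * l ^ α)) := by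
    intro t l hl
    rw [← (hls t).integral_exp h0 h1 hl, integral_map (hs t).aemeasurable (by fun_prop)]
  set Y : Ω → ℝ := fun ω ↦ ∑ t ∈ Finset.univ.erase i, x t * (s t ω * r t ω) with hY_def
  have hY : Measurable Y := by fun_prop
  have hY0 : ∀ᵐ ω ∂P, 0 ≤ Y ω := by
    filter_upwards [ae_all_iff.2 hs0, ae_all_iff.2 hr0] with ω h2 h3
    exact Finset.sum_nonneg fun t _ ↦ mul_nonneg (hx t) (mul_nonneg (h2 t).le (h3 t))
  -- independence within the column
  have hYr : IndepFun (r i) (fun ω ↦ (s i ω, Y ω)) P := by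
    have hI := indep_iSup_of_disjoint (fun p ↦ (hfm p).comap_le) hind
      (S := {Sum.inr i}) (T := {Sum.inr i}ᶜ) disjoint_compl_right
    refine Indep.indepFun_of_measurable hI
      (measurable_biSup_comap (Sum.elim s r) (Set.mem_singleton (Sum.inr i))) ?_
    refine Measurable.prodMk (measurable_biSup_comap (Sum.elim s r) (i := Sum.inl i) (by simp)) ?_
    refine Finset.measurable_sum _ fun t ht ↦ ?_
    have ht' : t ≠ i := Finset.ne_of_mem_erase ht
    exact ((measurable_biSup_comap (Sum.elim s r) (i := Sum.inl t) (by simp)).mul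
      (measurable_biSup_comap (Sum.elim s r) (i := Sum.inr t) (by simpa using ht'))).const_mul _
  have hsY : IndepFun (s i) Y P := by
    have hI := indep_iSup_of_disjoint (fun p ↦ (hfm p).comap_le) hind
      (S := {Sum.inl i}) (T := {Sum.inl i}ᶜ) disjoint_compl_right
    refine Indep.indepFun_of_measurable hI
      (measurable_biSup_comap (Sum.elim s r) (Set.mem_singleton (Sum.inl i))) ?_
    refine Finset.measurable_sum _ fun t ht ↦ ?_
    have ht' : t ≠ i := Finset.ne_of_mem_erase ht
    exact ((measurable_biSup_comap (Sum.elim s r) (i := Sum.inl t) (by simpa using ht')).mul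
      (measurable_biSup_comap (Sum.elim s r) (i := Sum.inr t) (by simp))).const_mul _
  have hprod : iIndepFun (fun t ω ↦ x t * (s t ω * r t ω)) P := by
    have hI := iIndepFun.iIndep_biSup hind hfm
      (S := fun t : Fin N ↦ ({Sum.inl t, Sum.inr t} : Set (Fin N ⊕ Fin N))) (by
        intro a b hab
        simp [hab.symm])
    refine iIndep.iIndepFun_of_measurable hI fun t ↦ ?_
    exact ((measurable_biSup_comap (Sum.elim s r) (i := Sum.inl t) (by simp)).mul
      (measurable_biSup_comap (Sum.elim s r) (i := Sum.inr t) (by simp))).const_mul _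
  have hsr : ∀ t, IndepFun (s t) (r t) P := fun t ↦
    hind.indepFun (i := Sum.inl t) (j := Sum.inr t) (by simp)
  -- Laplace transform of `Y`
  have hκα : 0 < κ ^ α := Real.rpow_pos_of_pos hκ _
  -- A single exponent dominating `c * x t ^ α` for every nonzero `x t`, so all competitors are
  -- treated as equal in size.
  set ρ := c * (θ * κ ^ α) with hρ_def
  have hρ : 0 < ρ := by positivity
  have hYL : ∀ l : ℝ, 0 < l →
      (1 - γ + γ * Real.exp (-(ρ * l ^ α))) ^ n ≤ ∫ ω, Real.exp (-l * Y ω) ∂P := by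
    intro l hl
    have e1 : ∫ ω, Real.exp (-l * Y ω) ∂P =
        ∏ t ∈ Finset.univ.erase i, mgf (fun ω ↦ x t * (s t ω * r t ω)) P (-l) := by
      rw [← hprod.mgf_sum (fun t ↦ by fun_prop)]
      simp [mgf, hY_def]
    have e2 : ∀ t, mgf (fun ω ↦ x t * (s t ω * r t ω)) P (-l) =
        1 - γ + γ * mgf (s t) P (-(l * x t)) := by
      intro t
      rw [← mgf_mul_bernoulli (hs t) (hr t) (hsr t) (hlr t) ((hs0 t).mono fun ω h ↦ h.le)
        (mul_nonneg hl.le (hx t)), mgf_const_mul]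
      congr 1
      ring
    rw [e1, ← hn, ← Finset.prod_const]
    -- Zero coordinates contribute the factor `1`, so only the `n` nonzero competitors remain.
    rw [← Finset.prod_filter_of_ne (s := Finset.univ.erase i)
      (f := fun t ↦ mgf (fun ω ↦ x t * (s t ω * r t ω)) P (-l)) (p := fun t ↦ x t ≠ 0)]
    · refine Finset.prod_le_prod (fun t _ ↦ ?_) fun t ht ↦ ?_
      · have h6 : (0 : ℝ) ≤ 1 - γ := by linarith
        positivity
      · have hxt : x t ≠ 0 := (Finset.mem_filter.1 ht).2
        have hxt' : 0 < x t := lt_of_le_of_ne (hx t) hxt.symm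
        rw [e2]
        have : mgf (s t) P (-(l * x t)) = Real.exp (-(c * (l * x t) ^ α)) :=
          hL t (l * x t) (by positivity)
        rw [this, Real.mul_rpow hl.le (hx t)]
        have : c * (l ^ α * x t ^ α) ≤ ρ * l ^ α := by
          have h5 : 0 ≤ l ^ α := by positivity
          have := mul_le_mul_of_nonneg_left (hθx t hxt) (mul_nonneg hc.le h5)
          calc c * (l ^ α * x t ^ α) = c * l ^ α * x t ^ α := by ring
            _ ≤ c * l ^ α * (θ * κ ^ α) := this
            _ = _ := by rw [hρ_def]; ring
        gcongr
    · intro t _ hne hxt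
      apply hne
      rw [e2, hxt]
      simp [mgf]
  -- comparison of the Laplace integrals
  have hZL : ∀ l : ℝ, 0 < l → ∫ ω, Real.exp (-l * (κ * s i ω)) ∂P
      = Real.exp (-(c * κ ^ α * l ^ α)) := by
    intro l hl
    have := hL i (l * κ) (by positivity)
    rw [Real.mul_rpow hl.le hκ.le] at this
    rw [show c * κ ^ α * l ^ α = c * (l ^ α * κ ^ α) by ring, ← this]
    simp only [neg_mul, mul_assoc]
  have hZ : Measurable fun ω ↦ κ * s i ω := by fun_prop
  have hZ0 : ∀ᵐ ω ∂P, 0 < κ * s i ω := (hs0 i).mono fun ω h ↦ by positivity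
  have hθ0 : 0 < θ := by linarith
  obtain ⟨hgi, hgint⟩ := integral_Ioi_binomial_exp h0 hρ hγ' hγ1 n
  have hE : θ⁻¹ * ((1 - (1 - (γ : ℝ)) ^ (n + 1)) / ((n + 1) * γ)) ≤
      ∫ ω, κ * s i ω / (Y ω + κ * s i ω) ∂P := by
    rw [← hgint, ← integral_const_mul]
    refine integral_le_integral_div_add hY hZ
      (hsY.comp (φ := fun z ↦ κ * z) (ψ := id) (by fun_prop) measurable_id) hY0 hZ0
      (fun l hl ↦ ?_) (hgi.const_mul _) (fun l hl ↦ ?_)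
    · have hl : 0 < l := hl
      have : (0 : ℝ) ≤ 1 - γ := by linarith
      positivity
    · have hl : 0 < l := hl
      rw [integral_mul_exp_of_laplace hZ (hZ0.mono fun ω h ↦ h.le) hZL hl, ← mul_assoc]
      have h6 : (0 : ℝ) ≤ 1 - γ := by linarith
      refine mul_le_mul ?_ (hYL l hl) (by positivity) (by positivity)
      -- The factor `θ⁻¹` restores the exact prefactor of the tilted moment; raising the exponent to
      -- `ρ` only decreases the exponential.
      have h7 : θ⁻¹ * ρ = c * κ ^ α := by rw [hρ_def]; field_simp
      calc θ⁻¹ * (ρ * (α * l ^ (α - 1)) * Real.exp (-(ρ * l ^ α)))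
          = c * κ ^ α * (α * l ^ (α - 1)) * Real.exp (-(ρ * l ^ α)) := by
            rw [← h7]; ring
        _ ≤ _ := by
            have : c * κ ^ α ≤ ρ := by
              rw [hρ_def]
              have := mul_le_mul_of_nonneg_right hθ hκα.le
              nlinarith
            gcongr
  have hM := one_sub_le_measureReal_le_mul hY (hs i) hY0 (hs0 i) hε hκ
  -- The indicator `r i` is independent of `(s i, Y)`, whence the factor `γ`.
  have hfac : P.real {ω | r i ω = 1 ∧ Y ω ≤ ε * s i ω} = γ * P.real {ω | Y ω ≤ ε * s i ω} := by
    have h8 := hYr.measure_inter_preimage_eq_mul {1} {p : ℝ × ℝ | p.2 ≤ ε * p.1}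
      (measurableSet_singleton 1) (measurableSet_le (by fun_prop) (by fun_prop))
    have h9 : P.real (r i ⁻¹' {1}) = γ := by
      rw [← map_measureReal_apply (hr i) (measurableSet_singleton 1), hlr,
        bernoulliMeasure_real_apply_of_mem_of_notMem _ (measurableSet_singleton 1) (by simp)
          (by simp)]
    have h10 := congrArg ENNReal.toReal h8
    rw [ENNReal.toReal_mul] at h10
    rw [← h9]
    exact h10
  rw [hfac]
  refine mul_le_mul_of_nonneg_left (le_trans ?_ hM) hγ'.le
  have : 0 ≤ 1 + κ / ε := by positivity
  have := mul_le_mul_of_nonneg_left hE this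
  linarith

end

/-! ### All measurements together -/

/-- The `j`-th measurement does not determine the `i`-th coordinate up to `ε`. -/
def uninformative {Ω : Type*} {N M : ℕ} (x : Fin N → ℝ) (ε : ℝ)
    (s r : Fin N → Fin M → Ω → ℝ) (i : Fin N) (j : Fin M) : Set Ω :=
  {ω | ¬ (r i j ω = 1 ∧
    ∑ t ∈ Finset.univ.erase i, x t * (s t j ω * r t j ω) ≤ ε * s i j ω)}

lemma measurableSet_uninformative {Ω : Type*} {m : MeasurableSpace Ω} {N M : ℕ}
    {s r : Fin N → Fin M → Ω → ℝ}
    (x : Fin N → ℝ) (ε : ℝ) (i : Fin N) (j : Fin M) (hs : ∀ t, Measurable (s t j))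
    (hr : ∀ t, Measurable (r t j)) : MeasurableSet (uninformative x ε s r i j) := by
  have h : MeasurableSet {ω | ∑ t ∈ Finset.univ.erase i, x t * (s t j ω * r t j ω) ≤ ε * s i j ω} :=
    measurableSet_le (by fun_prop) (by fun_prop)
  exact ((hr i (measurableSet_singleton 1)).inter h).compl

section
variable {Ω : Type*} [MeasurableSpace Ω] {P : Measure Ω} [IsProbabilityMeasure P]
  {N M : ℕ} {α : ℝ} {γ : unitInterval} {s r : Fin N → Fin M → Ω → ℝ}

lemma measureReal_uninformative_le (h0 : 0 < α) (h1 : α < 1) (hγ : 0 < γ)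
    (hd : SparseCC.IsSparseStableDesign α γ s r P) {x : Fin N → ℝ} (hx : ∀ t, 0 ≤ x t) (i : Fin N)
    (j : Fin M)    {ε κ θ : ℝ} (hε : 0 < ε) (hκ : 0 < κ) (hθ : 1 ≤ θ)
    (hθx : ∀ t, x t ≠ 0 → x t ^ α ≤ θ * κ ^ α) {n : ℕ}
    (hn : ((Finset.univ.erase i).filter fun t ↦ x t ≠ 0).card = n) {q : ℝ}
    (hq : q = (γ : ℝ) * (1 - (1 + κ / ε) *
      (1 - θ⁻¹ * ((1 - (1 - γ) ^ (n + 1)) / ((n + 1) * γ))))) :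
    P.real (uninformative x ε s r i j) ≤ 1 - q := by
  have hind : iIndepFun (Sum.elim (fun t ↦ s t j) (fun t ↦ r t j)) P := by
    have := hd.indep.precomp (g := Sum.map (fun t : Fin N ↦ (t, j)) (fun t : Fin N ↦ (t, j)))
      (Sum.map_injective.2 ⟨fun a b h ↦ (Prod.ext_iff.1 h).1, fun a b h ↦ (Prod.ext_iff.1 h).1⟩)
    convert! this using 1
    ext (t | t) <;> rfl
  have h2 := le_measureReal_informative h0 h1 hγ (fun t ↦ hd.measurable_s t j)
    (fun t ↦ hd.measurable_r t j) (fun t ↦ hd.law_s t j) (fun t ↦ hd.law_r t j) hind hx i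
    hε hκ hθ hθx hn
  rw [← hq] at h2
  have hm := measurableSet_uninformative (m := inferInstance) x ε i j
    (fun t ↦ hd.measurable_s t j) (fun t ↦ hd.measurable_r t j)
  have h3 := probReal_compl_eq_one_sub (μ := P) hm
  have h4 : (uninformative x ε s r i j)ᶜ = {ω | r i j ω = 1 ∧
      ∑ t ∈ Finset.univ.erase i, x t * (s t j ω * r t j ω) ≤ ε * s i j ω} := by
    ext ω; simp [uninformative]
  rw [h4] at h3
  linarith

lemma measureReal_iInter_uninformative_le (h0 : 0 < α) (h1 : α < 1) (hγ : 0 < γ)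
    (hd : SparseCC.IsSparseStableDesign α γ s r P) {x : Fin N → ℝ} (hx : ∀ t, 0 ≤ x t) (i : Fin N)
    {ε κ θ : ℝ} (hε : 0 < ε) (hκ : 0 < κ) (hθ : 1 ≤ θ)
    (hθx : ∀ t, x t ≠ 0 → x t ^ α ≤ θ * κ ^ α) {n : ℕ}
    (hn : ((Finset.univ.erase i).filter fun t ↦ x t ≠ 0).card = n) {q : ℝ}
    (hq : q = (γ : ℝ) * (1 - (1 + κ / ε) *
      (1 - θ⁻¹ * ((1 - (1 - γ) ^ (n + 1)) / ((n + 1) * γ))))) :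
    P.real (⋂ j, uninformative x ε s r i j) ≤ (1 - q) ^ M := by
  have hfm : ∀ p, Measurable (Sum.elim (fun p : Fin N × Fin M => s p.1 p.2)
      (fun p : Fin N × Fin M => r p.1 p.2) p) := by
    rintro (t | t)
    exacts [hd.measurable_s _ _, hd.measurable_r _ _]
  -- Grouping the variables by column makes the failure events independent across `j`.
  have hI := iIndepFun.iIndep_biSup hd.indep hfm
    (S := fun j : Fin M ↦ {p | Sum.elim Prod.snd Prod.snd p = j}) (by
      intro a b hab
      refine Set.disjoint_left.2 fun p h2 h3 ↦ hab (h2.symm.trans h3))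
  have hprod := (iIndep_iff _ _).1 hI Finset.univ (f := fun j ↦ uninformative x ε s r i j) (by
    intro j _
    refine measurableSet_uninformative x ε i j (fun t ↦ ?_) (fun t ↦ ?_)
    · exact measurable_biSup_comap (Sum.elim (fun p : Fin N × Fin M => s p.1 p.2)
        (fun p : Fin N × Fin M => r p.1 p.2)) (i := Sum.inl (t, j)) rfl
    · exact measurable_biSup_comap (Sum.elim (fun p : Fin N × Fin M => s p.1 p.2)
        (fun p : Fin N × Fin M => r p.1 p.2)) (i := Sum.inr (t, j)) rfl)
  have hprod' : P.real (⋂ j, uninformative x ε s r i j) =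
      ∏ j, P.real (uninformative x ε s r i j) := by
    have := congrArg ENNReal.toReal hprod
    rw [ENNReal.toReal_prod] at this
    simpa [measureReal_def] using this
  rw [hprod']
  have hcol := fun j ↦ measureReal_uninformative_le h0 h1 hγ hd hx i j hε hκ hθ hθx hn hq
  calc ∏ j, P.real (uninformative x ε s r i j) ≤ ∏ _j : Fin M, (1 - q) :=
        Finset.prod_le_prod (fun j _ ↦ measureReal_nonneg) fun j _ ↦ hcol j
    _ = (1 - q) ^ M := by simp

lemma SparseCC.IsSparseStableDesign.ae_pos (h0 : 0 < α) (h1 : α < 1)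
    (hd : SparseCC.IsSparseStableDesign α γ s r P) :
    ∀ᵐ ω ∂P, ∀ i j, 0 < s i j ω ∧ (r i j ω = 1 ∨ r i j ω = 0) := by
  refine ae_all_iff.2 fun i ↦ ae_all_iff.2 fun j ↦ ?_
  have hprob : IsProbabilityMeasure (P.map (s i j)) :=
    Measure.isProbabilityMeasure_map (hd.measurable_s i j).aemeasurable
  have e1 : ∀ᵐ y ∂(P.map (s i j)), 0 < y := by
    filter_upwards [measure_eq_zero_iff_ae_notMem.1 ((hd.law_s i j).measure_Iic_zero h0 h1)]
      with y hy
    simpa using hy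
  have e2 : ∀ᵐ y ∂(P.map (r i j)), y = 1 ∨ y = 0 := by
    rw [hd.law_r, bernoulliMeasure_def, ae_add_measure_iff]
    constructor
    · exact Measure.ae_smul_measure (by simp [ae_dirac_eq]) _
    · exact Measure.ae_smul_measure (by simp [ae_dirac_eq]) _
  filter_upwards [ae_of_ae_map (hd.measurable_s i j).aemeasurable e1,
    ae_of_ae_map (hd.measurable_r i j).aemeasurable e2] with ω h2 h3 using ⟨h2, h3⟩

end

/-! ### Deterministic bounds on the estimator -/

lemma SparseCC.measurement_eq {N M : ℕ} (x : Fin N → ℝ) (s r : Fin N → Fin M → ℝ) (i : Fin N)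
    (j : Fin M) : SparseCC.measurement x s r j =
      x i * (s i j * r i j) + ∑ t ∈ Finset.univ.erase i, x t * (s t j * r t j) :=
  (Finset.add_sum_erase _ _ (Finset.mem_univ i)).symm

lemma SparseCC.le_minRatioEstimator {N M : ℕ} {x : Fin N → ℝ} {s r : Fin N → Fin M → ℝ}
    (hx : ∀ i, 0 ≤ x i) (h : ∀ i j, 0 < s i j ∧ (r i j = 1 ∨ r i j = 0)) (i : Fin N) :
    (x i : EReal) ≤ SparseCC.minRatioEstimator s r (SparseCC.measurement x s r) i := by
  refine le_iInf₂ fun j hj ↦ ?_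
  have hj : r i j = 1 := hj
  rw [EReal.coe_le_coe_iff, SparseCC.measurement_eq x s r i j, hj, mul_one,
    le_div_iff₀ (h i j).1, le_add_iff_nonneg_right]
  refine Finset.sum_nonneg fun t _ ↦ mul_nonneg (hx t) (mul_nonneg (h t j).1.le ?_)
  rcases (h t j).2 with h | h <;> simp [h]

lemma SparseCC.minRatioEstimator_le {N M : ℕ} {x : Fin N → ℝ} {s r : Fin N → Fin M → ℝ} {ε : ℝ}
    {i : Fin N} {j : Fin M} (hs : 0 < s i j) (hr : r i j = 1)
    (hle : ∑ t ∈ Finset.univ.erase i, x t * (s t j * r t j) ≤ ε * s i j) :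
    SparseCC.minRatioEstimator s r (SparseCC.measurement x s r) i ≤ ((x i + ε : ℝ) : EReal) := by
  refine (iInf₂_le j hr).trans ?_
  rw [EReal.coe_le_coe_iff, SparseCC.measurement_eq x s r i j, hr, mul_one, div_le_iff₀ hs]
  linarith

/-! ### The limiting success probability and the choice of parameters -/

/-- The limiting probability, as `α → 0`, that a measurement determines a coordinate when `n`
other coordinates are nonzero. -/
noncomputable def limitSuccess (γ : ℝ) (n : ℕ) : ℝ := (1 - (1 - γ) ^ (n + 1)) / (n + 1)

lemma limitSuccess_eq {γ : ℝ} (n : ℕ) :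
    limitSuccess γ n = γ * (∑ k ∈ Finset.range (n + 1), (1 - γ) ^ k) / (n + 1) := by
  have := geom_sum_mul (1 - γ) (n + 1)
  rw [limitSuccess]
  congr 1
  linear_combination this

lemma limitSuccess_pos {γ : ℝ} (h0 : 0 < γ) (h1 : γ ≤ 1) (n : ℕ) : 0 < limitSuccess γ n := by
  have : (1 - γ) ^ (n + 1) < 1 := pow_lt_one₀ (by linarith) (by linarith) (by simp)
  exact div_pos (by linarith) (by positivity)

/-- Up to the factor `γ` this is the average of `(1 - γ) ^ k` over `k ≤ n`, and each new power lies
strictly below the average so far. -/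
lemma limitSuccess_strictAnti {γ : ℝ} (h0 : 0 < γ) (h1 : γ ≤ 1) :
    StrictAnti (limitSuccess γ) := by
  refine strictAnti_nat_of_succ_lt fun n ↦ ?_
  rw [limitSuccess_eq, limitSuccess_eq, Finset.sum_range_succ _ (n + 1)]
  set A := ∑ k ∈ Finset.range (n + 1), (1 - γ) ^ k
  have hA : (n + 1) * (1 - γ) ^ (n + 1) < A := by
    have : ∑ k ∈ Finset.range (n + 1), (1 - γ) ^ (n + 1) < A := by
      refine Finset.sum_lt_sum (fun k hk ↦ ?_) ⟨0, by simp, ?_⟩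
      · exact pow_le_pow_of_le_one (by linarith) (by linarith) (Finset.mem_range.1 hk).le
      · rw [pow_zero]
        exact pow_lt_one₀ (by linarith) (by linarith) (by simp)
    simpa using this
  rw [div_lt_div_iff₀ (by positivity) (by positivity)]
  push_cast
  nlinarith

lemma limitSuccess_le_one {γ : ℝ} (h1 : γ ≤ 1) (n : ℕ) : limitSuccess γ n ≤ 1 := by
  have h2 : 0 ≤ (1 - γ) ^ (n + 1) := pow_nonneg (by linarith) _
  rw [limitSuccess, div_le_one (by positivity)]
  have : (0 : ℝ) ≤ n := n.cast_nonneg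
  linarith

lemma requiredMeasurements_eq (N K : ℕ) (γ δ : ℝ) : SparseCC.requiredMeasurements N K γ δ =
    1 / (-Real.log (1 - limitSuccess γ K)) * Real.log (N / δ) := by
  rw [SparseCC.requiredMeasurements, limitSuccess]
  ring_nf

lemma limitSuccess_lt_one {γ : ℝ} (h0 : 0 < γ) (h1 : γ ≤ 1) {K : ℕ} (hK : 1 ≤ K) :
    limitSuccess γ K < 1 :=
  ((limitSuccess_strictAnti h0 h1) (Nat.lt_of_lt_of_le Nat.zero_lt_one hK)).trans_le
    (limitSuccess_le_one h1 0)

lemma card_mul_pow_le_of_requiredMeasurements_le {N K M : ℕ} {γ δ : ℝ} (hN : 1 ≤ N) (hK : 1 ≤ K)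
    (h0 : 0 < γ) (h1 : γ ≤ 1) (hδ : 0 < δ) (hδ1 : δ < 1)
    (hM : SparseCC.requiredMeasurements N K γ δ ≤ M) :
    1 ≤ M ∧ N * (1 - limitSuccess γ K) ^ M ≤ δ := by
  have hp := limitSuccess_pos h0 h1 K
  have hp1 := limitSuccess_lt_one h0 h1 hK
  have hlog : 0 < -Real.log (1 - limitSuccess γ K) := by
    have := Real.log_neg (x := 1 - limitSuccess γ K) (by linarith) (by linarith)
    linarith
  have hN' : (1 : ℝ) ≤ N := by exact_mod_cast hN
  have hNδ : 1 < N / δ := (one_lt_div hδ).2 (by linarith)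
  have hlogN : 0 < Real.log (N / δ) := Real.log_pos hNδ
  rw [requiredMeasurements_eq] at hM
  constructor
  · have : (0 : ℝ) < M := lt_of_lt_of_le (by positivity) hM
    exact_mod_cast this
  · rw [one_div_mul_eq_div, div_le_iff₀ hlog] at hM
    have h2 : Real.log ((1 - limitSuccess γ K) ^ M) ≤ Real.log (δ / N) := by
      rw [Real.log_pow, ← inv_div, Real.log_inv]
      linarith
    have h3 := (Real.log_le_log_iff (by have : 0 < 1 - limitSuccess γ K := by linarith
                                        positivity) (by positivity)).1 h2
    rw [le_div_iff₀ (by positivity)] at h3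
    linarith

/-- Erasing an index of the support leaves fewer than `K` competitors; if `x = 0`, any index works
because `K ≥ 1`. This is the source of strict slack in the union bound. -/
lemma card_nonzero_ne {N K : ℕ} {x : Fin N → ℝ} (hN : 1 ≤ N) (hK : 1 ≤ K)
    (hx : {i | x i ≠ 0}.ncard ≤ K) :
    (∀ i, ((Finset.univ.erase i).filter fun t ↦ x t ≠ 0).card ≤ K) ∧
      ∃ i, ((Finset.univ.erase i).filter fun t ↦ x t ≠ 0).card < K := by
  have hA : (Finset.univ.filter fun t ↦ x t ≠ 0).card ≤ K := by
    rw [Set.ncard_eq_toFinset_card'] at hx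
    simpa using hx
  simp only [Finset.filter_erase]
  refine ⟨fun i ↦ (Finset.card_le_card (Finset.erase_subset _ _)).trans hA, ?_⟩
  rcases (Finset.univ.filter fun t ↦ x t ≠ 0).eq_empty_or_nonempty with h | ⟨i, hi⟩
  · exact ⟨⟨0, hN⟩, by rw [h]; simpa using Nat.lt_of_lt_of_le Nat.zero_lt_one hK⟩
  · exact ⟨i, (Finset.card_erase_lt_of_mem hi).trans_le hA⟩

/-- The bound for one measurement with `κ = u` and `θ = 1 + u`: a single parameter removes both
losses. -/
lemma tendsto_success_bound {γ ε : ℝ} (hγ : 0 < γ) (n : ℕ) :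
    Tendsto (fun u : ℝ ↦ γ * (1 - (1 + u / ε) *
      (1 - (1 + u)⁻¹ * ((1 - (1 - γ) ^ (n + 1)) / ((n + 1) * γ))))) (𝓝[>] 0)
      (𝓝 (limitSuccess γ n)) := by
  have h : ContinuousAt (fun u : ℝ ↦ γ * (1 - (1 + u / ε) *
      (1 - (1 + u)⁻¹ * ((1 - (1 - γ) ^ (n + 1)) / ((n + 1) * γ))))) 0 := by
    fun_prop (disch := norm_num)
  have h2 := h.tendsto.mono_left (nhdsWithin_le_nhds (s := Set.Ioi 0))
  convert h2 using 2
  have : ((n : ℝ) + 1) ≠ 0 := by positivity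
  rw [limitSuccess]
  simp only [zero_div, add_zero, inv_one, one_mul]
  field_simp
  ring

/-- For fixed `u`, both `x t ^ α` and `u ^ α` tend to `1`, and the factor `1 + u` leaves room. -/
lemma eventually_rpow_le {N : ℕ} {x : Fin N → ℝ} {u : ℝ} (hu : 0 < u) :
    ∀ᶠ α : ℝ in 𝓝[>] 0, ∀ t, x t ≠ 0 → x t ^ α ≤ (1 + u) * u ^ α := by
  refine eventually_all.2 fun t ↦ ?_
  by_cases hxt : x t = 0
  · exact .of_forall fun α h ↦ absurd hxt h
  · have h1 : Tendsto (fun α : ℝ ↦ x t ^ α) (𝓝[>] 0) (𝓝 1) := by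
      simpa using (Real.continuousAt_const_rpow hxt (b := 0)).tendsto.mono_left
        (nhdsWithin_le_nhds (s := Set.Ioi 0))
    have h2 : Tendsto (fun α : ℝ ↦ (1 + u) * u ^ α) (𝓝[>] 0) (𝓝 ((1 + u) * 1)) := by
      refine Tendsto.const_mul _ ?_
      simpa using (Real.continuousAt_const_rpow hu.ne' (b := 0)).tendsto.mono_left
        (nhdsWithin_le_nhds (s := Set.Ioi 0))
    filter_upwards [h1.eventually_lt h2 (by linarith)] with α h _ using h.le

theorem sample_complexity (N K : ℕ) (γ : unitInterval) (ε δ : ℝ) (x : Fin N → ℝ)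
    (hN : 1 ≤ N) (hK : 1 ≤ K) (hγ : 0 < γ) (hε : 0 < ε) (hδ : 0 < δ) (hδ1 : δ < 1)
    (hx : ∀ i, 0 ≤ x i) (hxK : {i | x i ≠ 0}.ncard ≤ K) :
    ∀ᶠ α : ℝ in 𝓝[>] 0, ∀ M : ℕ, SparseCC.requiredMeasurements N K γ δ ≤ M →
      ∀ (Ω : Type*) [MeasurableSpace Ω] (P : Measure Ω) [IsProbabilityMeasure P]
        (s r : Fin N → Fin M → Ω → ℝ), SparseCC.IsSparseStableDesign α γ s r P →
        1 - δ ≤ P.real {ω | ∀ i,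
          (x i : EReal) ≤ SparseCC.minRatioEstimator (fun i j => s i j ω) (fun i j => r i j ω)
              (SparseCC.measurement x (fun i j => s i j ω) (fun i j => r i j ω)) i ∧
          SparseCC.minRatioEstimator (fun i j => s i j ω) (fun i j => r i j ω)
              (SparseCC.measurement x (fun i j => s i j ω) (fun i j => r i j ω)) i
            ≤ ((x i + ε : ℝ) : EReal)} := by
  have hγ0 : (0 : ℝ) < γ := hγ
  have hγ1 : (γ : ℝ) ≤ 1 := γ.2.2
  obtain ⟨hnK, i₀, hi₀⟩ := card_nonzero_ne hN hK hxK
  set n : Fin N → ℕ := fun i ↦ ((Finset.univ.erase i).filter fun t ↦ x t ≠ 0).card with hn_def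
  -- All parameters are tuned for the smallest admissible `M`, so the range of `α` does not depend
  -- on `M`.
  set m := ⌈SparseCC.requiredMeasurements N K γ δ⌉₊ with hm_def
  obtain ⟨hm1, hm⟩ := card_mul_pow_le_of_requiredMeasurements_le hN hK hγ0 hγ1 hδ hδ1
    (Nat.le_ceil (SparseCC.requiredMeasurements N K γ δ))
  have hsum : ∑ i, (1 - limitSuccess γ (n i)) ^ m < δ := by
    refine lt_of_lt_of_le ?_ hm
    have e : (N : ℝ) * (1 - limitSuccess γ K) ^ m = ∑ _i : Fin N, (1 - limitSuccess γ K) ^ m := by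
      simp
    rw [← hm_def, e]
    have hle := (limitSuccess_strictAnti hγ0 hγ1).antitone
    refine Finset.sum_lt_sum (fun i _ ↦ ?_) ⟨i₀, Finset.mem_univ _, ?_⟩
    · have := hle (hnK i)
      have := limitSuccess_le_one hγ1 (n i)
      exact pow_le_pow_left₀ (by linarith) (by linarith) _
    · have := limitSuccess_strictAnti hγ0 hγ1 hi₀
      have := limitSuccess_le_one hγ1 (n i₀)
      exact pow_lt_pow_left₀ (by linarith) (by linarith) (by omega)
  set q : ℝ → Fin N → ℝ := fun u i ↦ γ * (1 - (1 + u / ε) *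
      (1 - (1 + u)⁻¹ * ((1 - (1 - γ) ^ (n i + 1)) / ((n i + 1) * γ)))) with hq_def
  have hq : ∀ i, Tendsto (fun u ↦ q u i) (𝓝[>] 0) (𝓝 (limitSuccess γ (n i))) :=
    fun i ↦ tendsto_success_bound hγ0 (n i)
  have hqs : Tendsto (fun u ↦ ∑ i, (1 - q u i) ^ m) (𝓝[>] 0)
      (𝓝 (∑ i, (1 - limitSuccess γ (n i)) ^ m)) :=
    tendsto_finsetSum _ fun i _ ↦ ((hq i).const_sub 1).pow m
  -- The strict inequality `hsum` survives a small perturbation: `u` is fixed here, before `α` is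
  -- sent to `0`.
  obtain ⟨u, hu1, hu2, hu⟩ := ((hqs.eventually_lt_const hsum).and
    ((eventually_all.2 fun i ↦ (hq i).eventually_const_lt (limitSuccess_pos hγ0 hγ1 (n i))).and
      self_mem_nhdsWithin)).exists
  have hu : 0 < u := hu
  filter_upwards [eventually_rpow_le (x := x) hu, Ioo_mem_nhdsGT (show (0 : ℝ) < 1 by norm_num)]
    with α hα hα01 M hM Ω _ P _ s r hd
  obtain ⟨h0, h1⟩ := hα01
  have hmM : m ≤ M := Nat.ceil_le.2 hM
  have hbad : ∀ i, P.real (⋂ j, uninformative x ε s r i j) ≤ (1 - q u i) ^ m := by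
    intro i
    have hb := measureReal_iInter_uninformative_le h0 h1 hγ hd hx i hε hu (by linarith) hα
      (n := n i) rfl rfl (q := q u i)
    -- Nonnegativity is read off from the bound on a probability for column `0`, which exists
    -- because `1 ≤ m ≤ M`.
    have h2 : 0 ≤ 1 - q u i := measureReal_nonneg.trans
      (measureReal_uninformative_le h0 h1 hγ hd hx i ⟨0, by omega⟩ hε hu (by linarith) hα
        (n := n i) rfl rfl)
    exact hb.trans (pow_le_pow_of_le_one h2 (by linarith [hu2 i]) hmM)
  have hmeas : MeasurableSet (⋃ i, ⋂ j, uninformative x ε s r i j) :=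
    MeasurableSet.iUnion fun i ↦ MeasurableSet.iInter fun j ↦
      measurableSet_uninformative x ε i j (fun t ↦ hd.measurable_s t j)
        (fun t ↦ hd.measurable_r t j)
  have hunion : P.real (⋃ i, ⋂ j, uninformative x ε s r i j) ≤ δ :=
    (measureReal_iUnion_fintype_le _).trans ((Finset.sum_le_sum fun i _ ↦ hbad i).trans hu1.le)
  have hcompl := probReal_compl_eq_one_sub (μ := P) hmeas
  calc 1 - δ ≤ P.real (⋃ i, ⋂ j, uninformative x ε s r i j)ᶜ := by linarith
    _ ≤ _ := by
      refine ENNReal.toReal_mono (measure_ne_top _ _) (measure_mono_ae ?_)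
      filter_upwards [hd.ae_pos h0 h1] with ω hω hmem i
      refine ⟨SparseCC.le_minRatioEstimator hx hω i, ?_⟩
      have hmem : ω ∉ ⋃ i, ⋂ j, uninformative x ε s r i j := hmem
      simp only [Set.mem_iUnion, Set.mem_iInter, not_exists, not_forall] at hmem
      obtain ⟨j, hj⟩ := hmem i
      simp only [uninformative, Set.mem_ofPred_eq, not_not] at hj
      exact SparseCC.minRatioEstimator_le (hω i j).1 hj.1 hj.2

/-! ### Comparison of the two measurement counts -/

lemma one_sub_exp_neg_le {γ : ℝ} (h0 : 0 < γ) (h1 : γ ≤ 1) (K : ℕ) :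
    1 - Real.exp (-γ * K) ≤ 1 - (1 - γ) ^ (K + 1) := by
  have h2 : (1 - γ) ^ K ≤ Real.exp (-γ) ^ K :=
    pow_le_pow_left₀ (by linarith) (Real.one_sub_le_exp_neg γ) K
  have h3 : (1 - γ) ^ (K + 1) ≤ (1 - γ) ^ K :=
    pow_le_pow_of_le_one (by linarith) (by linarith) (Nat.le_succ K)
  rw [← Real.exp_nat_mul, mul_comm] at h2
  linarith

/-- With `u = γ K`, Bernoulli's inequality and `1 - γ ≥ exp (-γ) (1 - γ²)` bound `K` times the left
side by `(u + u²) exp (-u)`, while `1 - exp (-u) ≥ (u + u²/2) exp (-u)`. The relative error is thus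
uniform in `γ`. -/
lemma exp_neg_sub_pow_le {γ : ℝ} (h0 : 0 < γ) (h1 : γ ≤ 1) {K : ℕ} (hK : 0 < K) :
    Real.exp (-γ * K) - (1 - γ) ^ (K + 1) ≤ 3 / K * (1 - Real.exp (-γ * K)) := by
  have hK' : (0 : ℝ) < K := by exact_mod_cast hK
  set u := γ * K with hu
  have hu0 : 0 < u := by positivity
  have e : -γ * K = -u := by rw [hu]; ring
  rw [e]
  have hE := Real.exp_pos (-u)
  have hEE : Real.exp u * Real.exp (-u) = 1 := by rw [← Real.exp_add]; simp
  have hquad := mul_le_mul_of_nonneg_right (Real.quadratic_le_exp_of_nonneg hu0.le) hE.le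
  rw [hEE] at hquad
  have ha : Real.exp (-γ) * (1 - γ ^ 2) ≤ 1 - γ := by
    have h2 : 1 + γ ≤ Real.exp γ := by linarith [Real.add_one_le_exp γ]
    have h3 : Real.exp γ * Real.exp (-γ) = 1 := by rw [← Real.exp_add]; simp
    have h4 : 1 - γ ^ 2 ≤ (1 - γ) * Real.exp γ := by nlinarith
    calc Real.exp (-γ) * (1 - γ ^ 2) ≤ Real.exp (-γ) * ((1 - γ) * Real.exp γ) := by gcongr
      _ = 1 - γ := by linear_combination (1 - γ) * h3
  have hpow : Real.exp (-u) * (1 - K * γ ^ 2) ≤ (1 - γ) ^ K := by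
    have h2 : 1 + (K : ℝ) * -γ ^ 2 ≤ (1 + -γ ^ 2) ^ K := one_add_mul_le_pow (by nlinarith) K
    have h3 : Real.exp (-u) = Real.exp (-γ) ^ K := by
      rw [← Real.exp_nat_mul, hu]; ring_nf
    have h4 : 0 ≤ 1 - γ ^ 2 := by nlinarith
    calc Real.exp (-u) * (1 - K * γ ^ 2) ≤ Real.exp (-γ) ^ K * (1 - γ ^ 2) ^ K := by
          rw [h3]
          refine mul_le_mul_of_nonneg_left ?_ (by positivity)
          calc 1 - K * γ ^ 2 = 1 + (K : ℝ) * -γ ^ 2 := by ring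
            _ ≤ _ := h2
            _ = _ := by ring_nf
      _ = (Real.exp (-γ) * (1 - γ ^ 2)) ^ K := (mul_pow _ _ _).symm
      _ ≤ _ := pow_le_pow_left₀ (by positivity) ha K
  have hpow2 : (1 - γ) ^ K ≤ Real.exp (-u) := by
    have := pow_le_pow_left₀ (by linarith) (Real.one_sub_le_exp_neg γ) K
    rw [← Real.exp_nat_mul] at this
    rwa [show (K : ℝ) * -γ = -u by rw [hu]; ring] at this
  rw [div_mul_eq_mul_div, le_div_iff₀ hK', pow_succ]
  have h5 : (Real.exp (-u) - (1 - γ) ^ K) * K ≤ u ^ 2 * Real.exp (-u) := by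
    have := mul_le_mul_of_nonneg_right hpow hK'.le
    calc (Real.exp (-u) - (1 - γ) ^ K) * K ≤
          (Real.exp (-u) - Real.exp (-u) * (1 - K * γ ^ 2)) * K := by linarith
      _ = u ^ 2 * Real.exp (-u) := by rw [hu]; ring
  have h6 : (1 - γ) ^ K * u ≤ Real.exp (-u) * u := by gcongr
  have h7 : (Real.exp (-u) - (1 - γ) ^ K * (1 - γ)) * K =
      (Real.exp (-u) - (1 - γ) ^ K) * K + (1 - γ) ^ K * u := by rw [hu]; ring
  rw [h7]
  nlinarith [mul_pos hu0 hE, mul_pos (pow_pos hu0 2) hE]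

theorem requiredMeasurements_asymptotic (η : ℝ) (hη : 0 < η) :
    ∃ K₀ : ℕ, ∀ K : ℕ, K₀ ≤ K →
      ∀ (N : ℕ) (γ δ : ℝ), 1 ≤ N → 0 < γ → γ ≤ 1 → 0 < δ → δ < 1 →
        |SparseCC.requiredMeasurements N K γ δ - SparseCC.approxMeasurements N K γ δ|
          ≤ η * SparseCC.approxMeasurements N K γ δ := by
  -- This makes `3 / K ≤ η`, which absorbs both the gap between `A` and `B` and the replacement of
  -- `K + 1` by `K`.
  refine ⟨⌈3 / η⌉₊ + 1, fun K hK N γ δ hN h0 h1 hδ hδ1 ↦ ?_⟩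
  have hK1 : 1 ≤ K := by omega
  have hK' : (0 : ℝ) < K := by exact_mod_cast hK1
  have hKη : 3 / K ≤ η := by
    have : 3 / η ≤ K := (Nat.le_ceil _).trans (by exact_mod_cast (by omega))
    rw [div_le_iff₀ hη] at this
    rw [div_le_iff₀ hK']
    linarith
  have hN' : (1 : ℝ) ≤ N := by exact_mod_cast hN
  have hL : 0 < Real.log (N / δ) := Real.log_pos ((one_lt_div hδ).2 (by linarith))
  have hp := limitSuccess_pos h0 h1 K
  have hp1 := limitSuccess_lt_one h0 h1 hK1
  rw [requiredMeasurements_eq, SparseCC.approxMeasurements, ← sub_mul, abs_mul, abs_of_pos hL,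
    ← mul_assoc]
  refine mul_le_mul_of_nonneg_right ?_ hL.le
  have hAB := one_sub_exp_neg_le h0 h1 K
  have hd := exp_neg_sub_pow_le h0 h1 hK1
  have hB : 0 < 1 - Real.exp (-γ * K) := by
    have : Real.exp (-γ * K) < 1 := Real.exp_lt_one_iff.2 (by nlinarith)
    linarith
  set B := 1 - Real.exp (-γ * K) with hB_def
  set A := 1 - (1 - γ) ^ (K + 1) with hA_def
  have hpA : limitSuccess γ K = A / (K + 1) := rfl
  have hA : 0 < A := hB.trans_le hAB
  have hA1 : A ≤ 1 := by
    have : 0 ≤ (1 - γ) ^ (K + 1) := pow_nonneg (by linarith) _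
    linarith
  have hAη : (1 - η) * A ≤ B := by
    have h2 : 3 / K * B ≤ η * B := mul_le_mul_of_nonneg_right hKη hB.le
    have h3 : η * B ≤ η * A := mul_le_mul_of_nonneg_left hAB hη.le
    linarith
  set p := limitSuccess γ K
  have hlog1 : p ≤ -Real.log (1 - p) := by
    have := Real.log_le_sub_one_of_pos (x := 1 - p) (by linarith)
    linarith
  have hlog2 : -Real.log (1 - p) ≤ p / (1 - p) := by
    have := Real.one_sub_inv_le_log_of_pos (x := 1 - p) (by linarith)
    have h2 : 1 - (1 - p)⁻¹ = -(p / (1 - p)) := by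
      have : 1 - p ≠ 0 := by linarith
      field_simp
      ring
    linarith
  have hup : 1 / (-Real.log (1 - p)) ≤ (K + 1) / B := by
    calc 1 / (-Real.log (1 - p)) ≤ 1 / p := one_div_le_one_div_of_le hp hlog1
      _ = (K + 1) / A := by rw [hpA, one_div_div]
      _ ≤ (K + 1) / B := by gcongr
  -- Here `(1 - p) / p = (K + 1 - A) / A`, and `A ≤ 1` brings the numerator down to `K`.
  have hlow : K / A ≤ 1 / (-Real.log (1 - p)) := by
    calc K / A ≤ (K + 1 - A) / A := by gcongr; linarith
      _ = 1 / (p / (1 - p)) := by rw [one_div_div, hpA]; field_simp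
      _ ≤ _ := one_div_le_one_div_of_le (hp.trans_le hlog1) hlog2
  rw [abs_le]
  constructor
  · have : (1 - η) * (K / B) ≤ K / A := by
      rw [← mul_div_assoc, div_le_div_iff₀ hB hA]
      nlinarith
    linarith
  · have : (K + 1) / B ≤ K / B + η * (K / B) := by
      rw [add_div]
      have h2 : 1 ≤ η * K := by
        rw [div_le_iff₀ hK'] at hKη
        linarith
      have : 1 / B ≤ (η * K) / B := by gcongr
      rw [← mul_div_assoc]
      linarith
    linarith

theorem mainTheorem1 :
    -- sample complexity as `α → 0+`
    (∀ (N K : ℕ) (γ : unitInterval) (ε δ : ℝ) (x : Fin N → ℝ),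
      1 ≤ N → 1 ≤ K → 0 < γ → 0 < ε → 0 < δ → δ < 1 →
      (∀ i, 0 ≤ x i) → {i | x i ≠ 0}.ncard ≤ K →
      ∀ᶠ α : ℝ in 𝓝[>] 0, ∀ M : ℕ, SparseCC.requiredMeasurements N K γ δ ≤ M →
        ∀ (Ω : Type*) [MeasurableSpace Ω] (P : Measure Ω) [IsProbabilityMeasure P]
          (s r : Fin N → Fin M → Ω → ℝ), SparseCC.IsSparseStableDesign α γ s r P →
          1 - δ ≤ P.real {ω | ∀ i,
            (x i : EReal) ≤ SparseCC.minRatioEstimator (fun i j => s i j ω) (fun i j => r i j ω)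
                (SparseCC.measurement x (fun i j => s i j ω) (fun i j => r i j ω)) i ∧
            SparseCC.minRatioEstimator (fun i j => s i j ω) (fun i j => r i j ω)
                (SparseCC.measurement x (fun i j => s i j ω) (fun i j => r i j ω)) i
              ≤ ((x i + ε : ℝ) : EReal)}) ∧
    -- the number of measurements is asymptotically `K / (1 - exp (-γ K)) * log (N / δ)`,
    -- uniformly in `γ`, `N`, `δ`, as `K → ∞`
    (∀ η : ℝ, 0 < η → ∃ K₀ : ℕ, ∀ K : ℕ, K₀ ≤ K →
      ∀ (N : ℕ) (γ δ : ℝ), 1 ≤ N → 0 < γ → γ ≤ 1 → 0 < δ → δ < 1 →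
        |SparseCC.requiredMeasurements N K γ δ - SparseCC.approxMeasurements N K γ δ|
          ≤ η * SparseCC.approxMeasurements N K γ δ) := by
  exact ⟨fun N K γ ε δ x ↦ sample_complexity N K γ ε δ x, requiredMeasurements_asymptotic⟩
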